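/- **Setting.** Let $D\subset\mathbb R^d$ be open and connected, and let $$Af(x)=\tfrac12\operatorname{Tr}\big(\mathbf Q(x)\nabla^2f(x)\big)+b(x)\cdot\nabla f(x)+\int_{\mathbb R^d}\Big(f(x+y)-f(x)-\frac{y\cdot\nabla f(x)}{1+|y|^2}\Big)N(x,dy),$$ where $\mathbf Q=[q_{i,j}]$ and $b$ are Borel measurable on $\mathbb R^d$ and bounded on $D$, $\mathbf Q(x)$ is non-negative definite for $x\in D$ (i.e. $\sum_{i,j} q_{i,j}(x)\xi_i\xi_j\ge0$ for all $\xi\in\mathbb R^d$), and $N(x,dy)$ is a measurable kernel of measures on $\mathbb R^d\setminus\{0\}$ with $\sup_{x\in\mathbb R^d}\int\min\{1,|y|^2\}N(x,dy)<\infty$. Let $c:D\to[0,\infty)$ be bounded and Borel, $\bar c_D:=\sup_Dc$, and let $g:D\to(-\infty,0]$ be Borel. Let $(X_t)_{t\ge0}$ be the canonical process on càdlàg paths and $(\mathcal F_t)$ its natural filtration. Assume that $(P_x)_{x\in\mathbb R^d}$ is a strong Markovian solution of the martingale problem for $A$, that is: $x\mapsto P_x(C)$ is measurable for each measurable set $C$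 of paths; $(X_t)$ is strongly Markovian with respect to $(\mathcal F_t)$ and $(P_x)$; and for each $x$ (resp. each Borel probability measure $\mu$ on $\mathbb R^d$) the measure $P=P_x$ (resp. $P=\int P_x\,\mu(dx)$) is a probability measure carried by the $\mathbb R^d$-valued càdlàg paths, under which $X_0$ has law $\delta_x$ (resp. $\mu$) and, for every $f\in C^2(\mathbb R^d)$ bounded with its derivatives of order $\le2$, the process $f(X_t)-f(X_0)-\int_0^tAf(X_r)\,dr$ is well defined and is an $(\mathcal F_t)$-martingale. Let $\tau_D:=\inf\{t>0:X_t\notin D\}$ and assume $P_x(\tau_D<\infty)=1$ for all $x\in D$. **Notation.** Let $\mathcal S(D):=\bigcup_{x\in D}\big(x+\operatorname{supp}N(x,\cdot)\big)$, $D_S:=D\cup\partial D\cup(\mathcal S(D)\setminus D)$, $\bar u_{D_S}:=\sup_{D_S}u$ and $e_c(t):=\exp\{-\int_0^tc(X_r)\,dr\}$. A bounded Borel function $u:\mathbb R^d\to\mathbb R$ is a *weak subsolution* of $(-A+c)v=g$ in $D$ if for all $x\in D$, $t\ge0$, $$u(x)\le\mathbb E_x\big[e_c(\tau_D\wedge t)\,u(X_{\tau_D\wedge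 t})\big]+\mathbb E_x\Big[\int_0^{\tau_D\wedge t}e_c(r)g(X_r)\,dr\Big].$$ For $\alpha\ge0$ and bounded Borel $f:D\to[0,\infty)$ let $R^D_\alpha f(x):=\mathbb E_x\int_0^{\tau_D}e^{-\alpha t}f(X_t)\,dt$. For $\psi:D\to[0,\infty)$ and a $\sigma$-finite Borel measure $\nu$ on $D$, the *minorization condition* $M(\alpha,\psi,\nu)$ says that $R^D_\alpha f(x)\ge\psi(x)\int_Df\,d\nu$ for all $x\in D$ and all bounded Borel $f:D\to[0,\infty)$. **Theorem 3.4 (the Hopf lemma).** Assume that $M(\bar c_D,\psi,\nu)$ holds for some $\psi:D\to(0,\infty)$ and some $\sigma$-finite Borel measure $\nu$ on $D$. 1. Suppose that $\operatorname{supp}\nu=D$ (support relative to $D$). If $u$ is a weak subsolution of $(-A+c)v=g$ in $D$ that is continuous in $D$ and not constant in $D$, with $\bar u_{D_S}\ge0$, then there is $a>0$ such that $$\bar u_{D_S}-u(x)\ge a\,\psi(x)\qquad\text{for all }x\in D.$$ 2. Let $m$ be a $\sigma$-finite Borel measure on $D$ with $m\ll\nu$. If $u$ is a weak subsolution of $(-A+c)v=g$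 in $D$ that is not $m$-a.e. equal to a constant in $D$, with $\bar u_{D_S}\ge0$, then the same conclusion holds. -/

import Mathlib

open MeasureTheory ProbabilityTheory Set Filter Topology
open scoped NNReal ENNReal

noncomputable section

namespace LevyHopf

/-- The Euclidean space `ℝ^d`. -/
abbrev Space (d : ℕ) : Type := EuclideanSpace ℝ (Fin d)

/-! ### The integro-differential operator -/

/-- The coefficients of the operator: the diffusion matrix `Q`, the drift `b` and the Lévy kernel
`N` (a measurable family of measures). -/
structure Coefficients (d : ℕ) where
  Q : Space d → Matrix (Fin d) (Fin d) ℝ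
  b : Space d → Space d
  N : Kernel (Space d) (Space d)

/-- The first hypothesis on the coefficients: `Q` and `b` are Borel measurable, bounded on `D`, and
`Q x` is non-negative definite for `x ∈ D`. -/
structure Coefficients.A1 {d : ℕ} (𝒜 : Coefficients d) (D : Set (Space d)) : Prop where
  measurable_Q : ∀ i j, Measurable fun x => 𝒜.Q x i j
  measurable_b : Measurable 𝒜.b
  bounded_Q : ∃ C : ℝ, ∀ x ∈ D, ∀ i j, |𝒜.Q x i j| ≤ C
  bounded_b : ∃ C : ℝ, ∀ x ∈ D, ‖𝒜.b x‖ ≤ C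
  nonneg_Q : ∀ x ∈ D, ∀ ξ : Fin d → ℝ, 0 ≤ ∑ i, ∑ j, 𝒜.Q x i j * ξ i * ξ j

/-- The second hypothesis on the coefficients: `N x` is a measure on `ℝ^d ∖ {0}`, and
`sup_x ∫ min(1, |y|²) N(x, dy) < ∞`. (In particular each `N x` is σ-finite.) -/
structure Coefficients.A2 {d : ℕ} (𝒜 : Coefficients d) : Prop where
  no_mass_zero : ∀ x, 𝒜.N x {0} = 0
  bounded_N : (⨆ x, ∫⁻ y, ENNReal.ofReal (min 1 (‖y‖ ^ 2)) ∂(𝒜.N x)) < ⊤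

/-- `A f (x) = ½ Tr(Q(x) ∇²f(x)) + b(x)·∇f(x)
  + ∫ (f(x+y) - f(x) - y·∇f(x) / (1+|y|²)) N(x, dy)`. -/
def Coefficients.op {d : ℕ} (𝒜 : Coefficients d) (f : Space d → ℝ) (x : Space d) : ℝ :=
  (1 / 2) * ∑ i, ∑ j, 𝒜.Q x i j *
      iteratedFDeriv ℝ 2 f x ![EuclideanSpace.single i 1, EuclideanSpace.single j 1]
    + fderiv ℝ f x (𝒜.b x)
    + ∫ y, (f (x + y) - f x - fderiv ℝ f x y / (1 + ‖y‖ ^ 2)) ∂(𝒜.N x)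

/-- `S_x = {x + y : y ∈ supp N(x, ·)}`. -/
def Coefficients.rangeAt {d : ℕ} (𝒜 : Coefficients d) (x : Space d) : Set (Space d) :=
  (fun y => x + y) '' (𝒜.N x).support

/-- The range of non-locality over `D`: `S(D) = ⋃_{x ∈ D} S_x`. -/
def Coefficients.range {d : ℕ} (𝒜 : Coefficients d) (D : Set (Space d)) : Set (Space d) :=
  ⋃ x ∈ D, 𝒜.rangeAt x

/-- The extended boundary `∂_S D = ∂D ∪ (S(D) ∖ D)`. -/
def Coefficients.extBoundary {d : ℕ} (𝒜 : Coefficients d) (D : Set (Space d)) : Set (Space d) :=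
  frontier D ∪ (𝒜.range D \ D)

/-- `D_S = ∂_S D ∪ D`. -/
def Coefficients.extDomain {d : ℕ} (𝒜 : Coefficients d) (D : Set (Space d)) : Set (Space d) :=
  𝒜.extBoundary D ∪ D

/-- `f ∈ C_b²(ℝ^d)`: `f` is `C²` and bounded together with its derivatives of order `≤ 2`. -/
def IsCb2 {d : ℕ} (f : Space d → ℝ) : Prop :=
  ContDiff ℝ 2 f ∧
    ∃ C : ℝ, ∀ x, |f x| ≤ C ∧ ‖fderiv ℝ f x‖ ≤ C ∧ ‖iteratedFDeriv ℝ 2 f x‖ ≤ C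

/-! ### Path space

All the path measures charge only `ℝ^d`-valued càdlàg paths, so they are taken as measures on the
space of these paths. The σ-algebra is the one generated by the coordinates, which is the Borel
σ-algebra of the Skorokhod topology. -/

/-- Càdlàg paths `[0, ∞) → ℝ^d`. -/
structure CadlagPath (d : ℕ) where
  toFun : ℝ≥0 → Space d
  right_continuous : ∀ t, ContinuousWithinAt toFun (Ici t) t
  left_limit : ∀ t, ∃ l, Tendsto toFun (𝓝[<] t) (𝓝 l)

instance {d : ℕ} : CoeFun (CadlagPath d) fun _ => ℝ≥0 → Space d := ⟨CadlagPath.toFun⟩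

instance {d : ℕ} : MeasurableSpace (CadlagPath d) := MeasurableSpace.comap CadlagPath.toFun inferInstance

theorem measurable_eval {d : ℕ} (t : ℝ≥0) : Measurable fun ω : CadlagPath d => ω t :=
  (measurable_pi_apply t).comp (comap_measurable CadlagPath.toFun)

/-- The natural filtration of the canonical process `X_t(ω) = ω(t)`. -/
def natFiltration (d : ℕ) :
    Filtration ℝ≥0 (inferInstance : MeasurableSpace (CadlagPath d)) :=
  Filtration.natural (fun t (ω : CadlagPath d) => ω t) fun t => (measurable_eval t).stronglyMeasurable

theorem tendsto_add_left_lt (t s : ℝ≥0) :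
    Tendsto (fun r : ℝ≥0 => t + r) (𝓝[<] s) (𝓝[<] (t + s)) := by
  refine tendsto_nhdsWithin_iff.2 ⟨?_, ?_⟩
  · exact ((continuous_const.add continuous_id).tendsto s).mono_left nhdsWithin_le_nhds
  · filter_upwards [self_mem_nhdsWithin] with r hr
    exact add_lt_add_right (mem_Iio.1 hr) t

/-- The shift `θ_t(ω)(s) = ω(t + s)`. -/
def shift {d : ℕ} (t : ℝ≥0) (ω : CadlagPath d) : CadlagPath d where
  toFun s := ω (t + s)
  right_continuous s :=
    (ω.right_continuous (t + s)).comp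
      ((continuous_const.add continuous_id).continuousWithinAt)
      (fun _ hr => add_le_add_right (mem_Ici.1 hr) t)
  left_limit s := by
    obtain ⟨l, hl⟩ := ω.left_limit (t + s)
    exact ⟨l, hl.comp (tendsto_add_left_lt t s)⟩

/-! ### The martingale problem -/

/-- `M_t[f] = f(X_t) - f(X_0) - ∫_0^t A f(X_r) dr`. -/
def Coefficients.mart {d : ℕ} (𝒜 : Coefficients d) (f : Space d → ℝ) (t : ℝ≥0) (ω : CadlagPath d) : ℝ :=
  f (ω t) - f (ω 0) - ∫ r in (0 : ℝ)..t, 𝒜.op f (ω r.toNNReal)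

/-- `Pμ` is a solution of the martingale problem for `A` with initial distribution `μ`. The time
integrals in `M_t[f]` are required to exist almost surely (which is automatic when the
coefficients are bounded on `ℝ^d`). -/
structure IsMartingaleSolution {d : ℕ} (𝒜 : Coefficients d) (μ : Measure (Space d))
    (Pμ : Measure (CadlagPath d)) : Prop where
  isProbabilityMeasure : IsProbabilityMeasure Pμ
  initial : Pμ.map (fun ω => ω 0) = μ
  integrable : ∀ f, IsCb2 f → ∀ t : ℝ≥0, ∀ᵐ ω ∂Pμ,
    IntervalIntegrable (fun r : ℝ => 𝒜.op f (ω r.toNNReal)) volume 0 t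
  martingale : ∀ f, IsCb2 f → Martingale (𝒜.mart f) (natFiltration d) Pμ

/-- The strong Markov property of the canonical process with respect to the natural filtration:
`P_x(Λ ∩ {T < ∞} ∩ θ_T⁻¹ B) = E_x[P_{X_T}(B); Λ ∩ {T < ∞}]` for every stopping time `T`,
`Λ ∈ ℱ_T` and measurable set `B` of paths. -/
def IsStrongMarkov {d : ℕ} (P : Kernel (Space d) (CadlagPath d)) : Prop :=
  ∀ (x : Space d) (T : CadlagPath d → WithTop ℝ≥0) (hT : IsStoppingTime (natFiltration d) T)
    (Λ : Set (CadlagPath d)), MeasurableSet[hT.measurableSpace] Λ →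
    ∀ B : Set (CadlagPath d), MeasurableSet B →
      P x (Λ ∩ {ω | T ω ≠ ⊤ ∧ shift ((T ω).untopD 0) ω ∈ B}) =
        ∫⁻ ω in Λ ∩ {ω | T ω ≠ ⊤}, P (ω ((T ω).untopD 0)) B ∂(P x)

/-- `(P_x)` is a strong Markovian solution of the martingale problem for `A`. That `P` is a
kernel says that `x ↦ P_x(C)` is measurable for each measurable set `C` of paths. -/
structure IsStrongMarkovSolution {d : ℕ} (𝒜 : Coefficients d) (P : Kernel (Space d) (CadlagPath d)) :
    Prop where
  solution : ∀ x, IsMartingaleSolution 𝒜 (Measure.dirac x) (P x)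
  strongMarkov : IsStrongMarkov P
  mixture : ∀ μ : Measure (Space d), IsProbabilityMeasure μ →
    IsMartingaleSolution 𝒜 μ (μ.bind P)

/-! ### Exit time, resolvent, minorization -/

/-- The exit time `τ_D = inf {t > 0 : X_t ∉ D}`, equal to `∞` if there is no such `t`. -/
def exitTime {d : ℕ} (D : Set (Space d)) (ω : CadlagPath d) : ℝ≥0∞ :=
  ⨅ (t : ℝ≥0) (_ : 0 < t ∧ ω t ∉ D), (t : ℝ≥0∞)

/-- `τ_D ∧ t`. -/
def exitMin {d : ℕ} (D : Set (Space d)) (t : ℝ≥0) (ω : CadlagPath d) : ℝ≥0 :=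
  (min (exitTime D ω) (t : ℝ≥0∞)).toNNReal

/-- The exit time from `D` is almost surely finite, from every starting point in `D`. -/
def ExitFinite {d : ℕ} (P : Kernel (Space d) (CadlagPath d)) (D : Set (Space d)) : Prop :=
  ∀ x ∈ D, ∀ᵐ ω ∂(P x), exitTime D ω < ⊤

/-- `f|_D ∈ B_b^+(D)`: the restriction of `f` to `D` is Borel, bounded and non-negative. -/
structure IsBddBorelNonnegOn {d : ℕ} (D : Set (Space d)) (f : Space d → ℝ) : Prop where
  measurable : Measurable fun x : D => f x
  nonneg : ∀ x ∈ D, 0 ≤ f x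
  bounded : ∃ C : ℝ, ∀ x ∈ D, f x ≤ C

/-- `R^D_α f(x) = E_x ∫_0^{τ_D} e^{-αt} f(X_t) dt` for `f ≥ 0` on `D`; the value may be `∞`. -/
def resolvent {d : ℕ} (P : Kernel (Space d) (CadlagPath d)) (D : Set (Space d)) (α : ℝ)
    (f : Space d → ℝ) (x : Space d) : ℝ≥0∞ :=
  ∫⁻ ω, (∫⁻ t in {t : ℝ | 0 < t ∧ ENNReal.ofReal t < exitTime D ω},
    ENNReal.ofReal (Real.exp (-α * t) * f (ω t.toNNReal))) ∂(P x)

/-- The minorization condition `M(α, ψ, ν)`: `R^D_α f(x) ≥ ψ(x) ∫_D f dν` for all `x ∈ D` and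
`f ∈ B_b^+(D)`. -/
def Minorization {d : ℕ} (P : Kernel (Space d) (CadlagPath d)) (D : Set (Space d)) (α : ℝ)
    (ψ : Space d → ℝ) (ν : Measure D) : Prop :=
  ∀ f : Space d → ℝ, IsBddBorelNonnegOn D f → ∀ x ∈ D,
    ENNReal.ofReal (ψ x) * ∫⁻ y, ENNReal.ofReal (f y) ∂ν ≤ resolvent P D α f x

/-! ### Weak subsolutions -/

/-- `e_c(t) = exp(-∫_0^t c(X_r) dr)`. -/
def expWeight {d : ℕ} (c : Space d → ℝ) (t : ℝ≥0) (ω : CadlagPath d) : ℝ :=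
  Real.exp (-∫ r in (0 : ℝ)..t, c (ω r.toNNReal))

/-- For `g ≤ 0` on `D`, the value of `-E_x ∫_0^{τ_D ∧ t} e_c(r) g(X_r) dr` in `[0, ∞]`. -/
def sourceTerm {d : ℕ} (P : Kernel (Space d) (CadlagPath d)) (D : Set (Space d))
    (c g : Space d → ℝ) (x : Space d) (t : ℝ≥0) : ℝ≥0∞ :=
  ∫⁻ ω, (∫⁻ r in Ioo (0 : ℝ) (exitMin D t ω),
    ENNReal.ofReal (-(expWeight c r.toNNReal ω * g (ω r.toNNReal)))) ∂(P x)

/-- `u ∈ B_b(ℝ^d)` is a weak subsolution of `(-A + c) v = g` in `D`, where `g ≤ 0` on `D`: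
`u(x) ≤ E_x[e_c(τ_D ∧ t) u(X_{τ_D ∧ t})] + E_x ∫_0^{τ_D ∧ t} e_c(r) g(X_r) dr` for all
`x ∈ D`, `t ≥ 0`. The last expectation may a priori be `-∞`, so this is an inequality in the
extended reals. -/
structure IsWeakSubsolution {d : ℕ} (P : Kernel (Space d) (CadlagPath d)) (D : Set (Space d))
    (c g u : Space d → ℝ) : Prop where
  measurable : Measurable u
  bounded : ∃ C : ℝ, ∀ x, |u x| ≤ C
  le_expectation : ∀ x ∈ D, ∀ t : ℝ≥0,
    (u x : EReal) ≤
      ((∫ ω, expWeight c (exitMin D t ω) ω * u (ω (exitMin D t ω)) ∂(P x) : ℝ) : EReal)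
        - ((sourceTerm P D c g x t : ℝ≥0∞) : EReal)

end LevyHopf

end

open LevyHopf

/-!
Let `k` be the supremum of `u` over `D` and its extended boundary, so that `w = k - u` is
non-negative there. Since `k ≥ 0`, `c ≥ 0` and `g ≤ 0`, the subsolution inequality says that `w` is
supermedian for the semigroup `P_t` of the process killed on leaving `D` and discounted at rate
`α = sup_D c`: `P_t w ≤ w` on `D` (`IsWeakSubsolution.killed_le`).

For such a `w`, the functions `f_n = w - P_n w ≥ 0` satisfy `R_α f_n ≤ n w`, because the time
integral of `P_s w - P_{s+n} w` telescopes (`lintegral_killed_sub_le`). The minorization condition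
then gives `ψ ∫ f_n dν ≤ n w`, and the constant `a = (∫ f_n dν) / n` works as soon as one of these
integrals is positive. If they all vanish, then `ν`-a.e. `w = P_n w` for every `n`, and `P_n w → 0`
because `w` is bounded and the exit time is finite; so `w = 0` holds `ν`-a.e.
(`exists_mul_le_of_supermedian`). Either hypothesis on `u` excludes this.

Two facts about the exit of the process from `D` are needed, and both follow from the martingale
problem through Dynkin's formula (`integral_stopped_sub`), itself an instance of optional stopping.

* The exit time need not be measurable for the natural filtration. It agrees almost surely with the
  limit `approachTime` of the entry times of shrinking neighbourhoods of the complement of `D`,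
  because a path whose left limit is on the boundary does not jump back into `D`
  (`ae_path_approachTime_notMem`). This makes the Markov property available for the killed process.
* The exit position lies in the closure of `D` or in the range of non-locality of the operator
  (`ae_path_approachTime_mem_extDomain`): for a test function vanishing on `D`, Dynkin's formula
  bounds the law of the exit position by the Lévy kernel integrated along the occupation measure of
  the path. The range of non-locality is only an analytic set, and compact subsets of the graph of
  admissible jumps take the place of its measurability.
-/

noncomputable section

namespace LevyHopf

/-! ### Measurability along càdlàg paths -/

/-- The point following `t` strictly on the grid of mesh `1 / (n + 1)`. -/
def gridTime (n : ℕ) (t : ℝ≥0) : ℝ≥0 := (⌊((n : ℝ≥0) + 1) * t⌋₊ + 1) / ((n : ℝ≥0) + 1)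

theorem lt_gridTime (n : ℕ) (t : ℝ≥0) : t < gridTime n t := by
  rw [gridTime, lt_div_iff₀ (by positivity), mul_comm]
  exact Nat.lt_floor_add_one _

theorem gridTime_le (n : ℕ) (t : ℝ≥0) : gridTime n t ≤ t + 1 / ((n : ℝ≥0) + 1) := by
  rw [gridTime, add_div]
  gcongr
  rw [div_le_iff₀ (by positivity), mul_comm t]
  exact Nat.floor_le (by positivity)

theorem tendsto_gridTime (t : ℝ≥0) : Tendsto (fun n => gridTime n t) atTop (𝓝[≥] t) := by
  refine tendsto_nhdsWithin_iff.2 ⟨?_, Eventually.of_forall fun n => (lt_gridTime n t).le⟩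
  refine tendsto_of_tendsto_of_tendsto_of_le_of_le tendsto_const_nhds ?_
    (fun n => (lt_gridTime n t).le) (fun n => gridTime_le n t)
  have : Tendsto (fun n : ℕ => 1 / ((n : ℝ≥0) + 1)) atTop (𝓝 0) :=
    tendsto_one_div_add_atTop_nhds_zero_nat
  simpa using this.const_add t

theorem measurable_path {d : ℕ} :
    Measurable fun p : CadlagPath d × ℝ≥0 => p.1 p.2 := by
  refine measurable_of_tendsto_metrizable (f := fun n p => p.1 (gridTime n p.2)) (fun n => ?_) ?_
  · have h : Measurable fun q : CadlagPath d × ℕ => q.1 (((q.2 : ℝ≥0) + 1) / ((n : ℝ≥0) + 1)) :=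
      measurable_from_prod_countable_left fun k =>
        measurable_eval (((k : ℝ≥0) + 1) / ((n : ℝ≥0) + 1))
    exact h.comp (measurable_fst.prodMk (Nat.measurable_floor.comp (measurable_snd.const_mul _)))
  · rw [tendsto_pi_nhds]
    exact fun p => (p.1.right_continuous p.2).tendsto.comp (tendsto_gridTime p.2)

theorem measurable_path_real {d : ℕ} :
    Measurable fun p : CadlagPath d × ℝ => p.1 p.2.toNNReal :=
  measurable_path.comp (measurable_fst.prodMk (measurable_real_toNNReal.comp measurable_snd))

theorem measurable_shift {d : ℕ} (t : ℝ≥0) : Measurable (shift (d := d) t) := by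
  rw [measurable_iff_comap_le]
  change MeasurableSpace.comap _ (MeasurableSpace.comap _ _) ≤ _
  rw [MeasurableSpace.comap_comp, ← measurable_iff_comap_le]
  exact measurable_pi_lambda _ fun s => measurable_eval (t + s)

theorem measurable_eval_natFiltration {d : ℕ} {r s : ℝ≥0} (h : r ≤ s) :
    Measurable[natFiltration d s] fun ω : CadlagPath d => ω r :=
  (((Filtration.stronglyAdapted_natural fun t =>
    (measurable_eval (d := d) t).stronglyMeasurable) r).mono
      ((natFiltration d).mono h)).measurable

/-- A path visiting an open set at time `r < s` visits it at a time of the dense sequence in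
`(r, s)`. -/
theorem exists_denseSeq_mem {d : ℕ} {U : Set (Space d)} (hU : IsOpen U) (ω : CadlagPath d)
    {r s : ℝ≥0} (hrs : r < s) (hr : ω r ∈ U) :
    ∃ k, r < TopologicalSpace.denseSeq ℝ≥0 k ∧ TopologicalSpace.denseSeq ℝ≥0 k < s ∧
      ω (TopologicalSpace.denseSeq ℝ≥0 k) ∈ U := by
  have h1 : ∀ᶠ q in 𝓝[>] r, ω q ∈ U :=
    ((ω.right_continuous r).mono Ioi_subset_Ici_self).eventually (hU.mem_nhds hr)
  obtain ⟨v, hv, hsub⟩ := (mem_nhdsGT_iff_exists_Ioo_subset' hrs).1 h1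
  obtain ⟨k, hq⟩ := (TopologicalSpace.denseRange_denseSeq ℝ≥0).exists_mem_open
    isOpen_Ioo (nonempty_Ioo.2 (lt_min hv hrs))
  exact ⟨k, hq.1, hq.2.trans_le (min_le_right _ _), hsub ⟨hq.1, hq.2.trans_le (min_le_left _ _)⟩⟩

/-! ### Entry times and survival -/

/-- The first entry time of `U`, truncated at `t`. -/
def entryBefore {d : ℕ} (U : Set (Space d)) (t : ℝ≥0) (ω : CadlagPath d) : ℝ≥0 :=
  sInf (insert t {r | ω r ∈ U})

/-- The open `1 / (n + 1)`-neighbourhoods of the complement of `D`. -/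
def nearCompl {d : ℕ} (D : Set (Space d)) (n : ℕ) : Set (Space d) :=
  Metric.thickening (1 / ((n : ℝ) + 1)) Dᶜ

/-- The first time, truncated at `t`, at which the path or its left limit meets the complement of
the open set `D`, as the limit of the entry times of the neighbourhoods of `Dᶜ`. Unlike the exit
time, it is measurable. -/
def approachTime {d : ℕ} (D : Set (Space d)) (t : ℝ≥0) (ω : CadlagPath d) : ℝ≥0 :=
  ⨆ n, entryBefore (nearCompl D n) t ω

/-- The event that up to time `t` the path keeps a positive distance from the complement
of `D`. -/
def survives {d : ℕ} (D : Set (Space d)) (t : ℝ≥0) : Set (CadlagPath d) :=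
  {ω | ∃ n, ∀ r ≤ t, ω r ∉ nearCompl D n}

section

variable {d : ℕ} {D U : Set (Space d)} {s t : ℝ≥0} {ω : CadlagPath d}

theorem entryBefore_le : entryBefore U t ω ≤ t := csInf_le (OrderBot.bddBelow _) (mem_insert _ _)

theorem entryBefore_lt_iff : entryBefore U t ω < s ↔ t < s ∨ ∃ r < s, ω r ∈ U := by
  rw [entryBefore, csInf_lt_iff (OrderBot.bddBelow _) (insert_nonempty _ _)]
  simp only [mem_insert_iff, mem_ofPred_eq, or_and_right, exists_or, exists_eq_left]
  simp only [and_comm]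

theorem notMem_of_lt_entryBefore {r : ℝ≥0} (h : r < entryBefore U t ω) : ω r ∉ U := fun hr =>
  h.not_ge (csInf_le (OrderBot.bddBelow _) (mem_insert_of_mem _ hr))

theorem path_entryBefore_mem_closure (h : entryBefore U t ω < t) :
    ω (entryBefore U t ω) ∈ closure U := by
  by_contra hc
  have h1 : ∀ᶠ q in 𝓝[≥] (entryBefore U t ω), ω q ∈ (closure U)ᶜ :=
    (ω.right_continuous _).eventually (isClosed_closure.isOpen_compl.mem_nhds hc)
  obtain ⟨v, hv, hsub⟩ := (mem_nhdsGE_iff_exists_Ico_subset' h).1 h1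
  rcases entryBefore_lt_iff.1 (lt_min hv h : entryBefore U t ω < min v t) with h2 | ⟨r, hr, hrU⟩
  · exact absurd h2 (not_lt.2 (min_le_right _ _))
  · exact hsub ⟨csInf_le (OrderBot.bddBelow _) (mem_insert_of_mem _ hrU),
      hr.trans_le (min_le_left _ _)⟩ (subset_closure hrU)

theorem measurableSet_entryBefore_lt (hU : IsOpen U) (t s : ℝ≥0) :
    MeasurableSet[natFiltration d s] {ω : CadlagPath d | entryBefore U t ω < s} := by
  by_cases hts : t < s
  · simp [entryBefore_lt_iff, hts]
  have : {ω : CadlagPath d | entryBefore U t ω < s} =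
      ⋃ k, {ω | TopologicalSpace.denseSeq ℝ≥0 k < s ∧ ω (TopologicalSpace.denseSeq ℝ≥0 k) ∈ U} := by
    ext ω
    simp only [mem_ofPred_eq, entryBefore_lt_iff, hts, false_or, mem_iUnion]
    constructor
    · rintro ⟨r, hr, hrU⟩
      obtain ⟨k, -, h2, h3⟩ := exists_denseSeq_mem hU ω hr hrU
      exact ⟨k, h2, h3⟩
    · rintro ⟨k, h1, h2⟩
      exact ⟨_, h1, h2⟩
  rw [this]
  refine MeasurableSet.iUnion fun k => ?_
  by_cases hk : TopologicalSpace.denseSeq ℝ≥0 k < s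
  · simp only [hk, true_and]
    exact measurable_eval_natFiltration hk.le hU.measurableSet
  · simp [hk]

theorem isOpen_nearCompl (D : Set (Space d)) (n : ℕ) : IsOpen (nearCompl D n) :=
  Metric.isOpen_thickening

theorem nearCompl_antitone (D : Set (Space d)) : Antitone (nearCompl D) := fun m n h =>
  Metric.thickening_mono (one_div_le_one_div_of_le (by positivity)
    (by exact_mod_cast Nat.succ_le_succ h)) _

theorem compl_subset_nearCompl (D : Set (Space d)) (n : ℕ) : Dᶜ ⊆ nearCompl D n :=
  Metric.self_subset_thickening (by positivity) _

/-- A compact subset of the open set `D` stays away from the complement of `D`. -/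
theorem exists_disjoint_closure_nearCompl (hD : IsOpen D) {K : Set (Space d)} (hK : IsCompact K)
    (hKD : K ⊆ D) : ∃ m, ∀ n ≥ m, Disjoint K (closure (nearCompl D n)) := by
  obtain ⟨δ, hδ, h⟩ := (disjoint_compl_right_iff_subset.2 hKD).exists_cthickenings hK
    hD.isClosed_compl
  obtain ⟨m, hm⟩ := exists_nat_one_div_lt hδ
  refine ⟨m, fun n hn => h.mono (Metric.self_subset_cthickening _) ?_⟩
  refine (closure_mono (nearCompl_antitone D hn)).trans
    ((Metric.closure_thickening_subset_cthickening _ _).trans (Metric.cthickening_mono hm.le _))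

theorem exists_notMem_closure_nearCompl (hD : IsOpen D) {x : Space d} (hx : x ∈ D) :
    ∃ m, ∀ n ≥ m, x ∉ closure (nearCompl D n) := by
  obtain ⟨m, hm⟩ := exists_disjoint_closure_nearCompl hD (isCompact_singleton (x := x))
    (singleton_subset_iff.2 hx)
  exact ⟨m, fun n hn => disjoint_singleton_left.1 (hm n hn)⟩

theorem bddAbove_entryBefore :
    BddAbove (range fun n => entryBefore (nearCompl D n) t ω) :=
  ⟨t, forall_mem_range.2 fun _ => entryBefore_le⟩

theorem entryBefore_le_approachTime (n : ℕ) :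
    entryBefore (nearCompl D n) t ω ≤ approachTime D t ω := le_ciSup bddAbove_entryBefore n

theorem approachTime_le : approachTime D t ω ≤ t := ciSup_le fun _ => entryBefore_le

theorem entryBefore_mono {V : Set (Space d)} (h : U ⊆ V) :
    entryBefore V t ω ≤ entryBefore U t ω :=
  csInf_le_csInf (OrderBot.bddBelow _) (insert_nonempty _ _)
    (insert_subset_insert fun _ hr => h hr)

theorem tendsto_entryBefore (D : Set (Space d)) (t : ℝ≥0) (ω : CadlagPath d) :
    Tendsto (fun n => entryBefore (nearCompl D n) t ω) atTop (𝓝 (approachTime D t ω)) :=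
  tendsto_atTop_ciSup (fun _ _ h => entryBefore_mono (nearCompl_antitone D h)) bddAbove_entryBefore

theorem path_mem_of_lt_approachTime {r : ℝ≥0} (h : r < approachTime D t ω) : ω r ∈ D := by
  obtain ⟨n, hn⟩ := exists_lt_of_lt_ciSup h
  by_contra hr
  exact notMem_of_lt_entryBefore hn (compl_subset_nearCompl D n hr)

theorem measurableSet_approachTime_lt (D : Set (Space d)) (t s : ℝ≥0) :
    MeasurableSet[natFiltration d s] {ω : CadlagPath d | approachTime D t ω < s} := by
  have : {ω : CadlagPath d | approachTime D t ω < s} = ⋃ k, ⋂ n,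
      {ω | TopologicalSpace.denseSeq ℝ≥0 k < s ∧
        entryBefore (nearCompl D n) t ω < TopologicalSpace.denseSeq ℝ≥0 k} := by
    ext ω
    simp only [mem_ofPred_eq, mem_iUnion, mem_iInter]
    constructor
    · intro h
      obtain ⟨k, hk⟩ := (TopologicalSpace.denseRange_denseSeq ℝ≥0).exists_mem_open
        isOpen_Ioo (nonempty_Ioo.2 h)
      exact ⟨k, fun n => ⟨hk.2, (entryBefore_le_approachTime n).trans_lt hk.1⟩⟩
    · rintro ⟨k, hk⟩
      exact (ciSup_le fun n => (hk n).2.le).trans_lt (hk 0).1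
  rw [this]
  refine MeasurableSet.iUnion fun k => MeasurableSet.iInter fun n => ?_
  by_cases hk : TopologicalSpace.denseSeq ℝ≥0 k < s
  · simpa [hk] using (natFiltration d).mono hk.le _
      (measurableSet_entryBefore_lt (isOpen_nearCompl D n) t _)
  · simp [hk]

/-- A random time that is optional for the natural filtration is measurable. -/
theorem measurable_of_optional {T : CadlagPath d → ℝ≥0}
    (hT : ∀ s, MeasurableSet[natFiltration d s] {ω | T ω < s}) : Measurable T :=
  measurable_of_Iio fun s => (natFiltration d).le s _ (hT s)

theorem measurable_path_at {T : CadlagPath d → ℝ≥0} (hT : Measurable T) :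
    Measurable fun ω : CadlagPath d => ω (T ω) :=
  measurable_path.comp (measurable_id.prodMk hT)

theorem measurable_approachTime (D : Set (Space d)) (t : ℝ≥0) :
    Measurable (approachTime (d := d) D t) :=
  measurable_of_optional (measurableSet_approachTime_lt D t)

theorem survives_iff_of_dense (D : Set (Space d)) (t : ℝ≥0) (ω : CadlagPath d) :
    ω ∈ survives D t ↔
      ∃ n, ∀ k, ω (min (TopologicalSpace.denseSeq ℝ≥0 k) t) ∉ nearCompl D n ∧
        ω t ∉ nearCompl D n := by
  refine exists_congr fun n => ⟨fun h k => ⟨h _ (min_le_right _ _), h _ le_rfl⟩, ?_⟩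
  intro h r hr hU
  rcases hr.eq_or_lt with rfl | hr
  · exact (h 0).2 hU
  · obtain ⟨k, -, h2, h3⟩ := exists_denseSeq_mem (isOpen_nearCompl D n) ω hr hU
    exact (h k).1 (by rwa [min_eq_left h2.le])

theorem measurableSet_survives_natFiltration (D : Set (Space d)) (t : ℝ≥0) :
    MeasurableSet[natFiltration d t] (survives (d := d) D t) := by
  have : survives (d := d) D t = ⋃ n, ⋂ k,
      {ω | ω (min (TopologicalSpace.denseSeq ℝ≥0 k) t) ∉ nearCompl D n ∧ ω t ∉ nearCompl D n} := by
    ext ω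
    simp only [survives_iff_of_dense, mem_iUnion, mem_iInter, mem_ofPred_eq]
  rw [this]
  refine MeasurableSet.iUnion fun n => MeasurableSet.iInter fun k => ?_
  exact (measurable_eval_natFiltration (min_le_right _ _)
      (isOpen_nearCompl D n).measurableSet.compl).inter
    (measurable_eval_natFiltration le_rfl (isOpen_nearCompl D n).measurableSet.compl)

theorem measurableSet_survives (D : Set (Space d)) (t : ℝ≥0) :
    MeasurableSet (survives (d := d) D t) :=
  (natFiltration d).le t _ (measurableSet_survives_natFiltration D t)

theorem measurableSet_survives_prod (D : Set (Space d)) :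
    MeasurableSet {p : CadlagPath d × ℝ≥0 | p.1 ∈ survives D p.2} := by
  have : {p : CadlagPath d × ℝ≥0 | p.1 ∈ survives D p.2} = ⋃ n, ⋂ k,
      {p | p.1 (min (TopologicalSpace.denseSeq ℝ≥0 k) p.2) ∉ nearCompl D n ∧
        p.1 p.2 ∉ nearCompl D n} := by
    ext p
    simp only [survives_iff_of_dense, mem_iUnion, mem_iInter, mem_ofPred_eq]
  rw [this]
  refine MeasurableSet.iUnion fun n => MeasurableSet.iInter fun k => ?_
  refine MeasurableSet.inter ?_ (measurable_path (isOpen_nearCompl D n).measurableSet.compl)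
  exact (measurable_path.comp (measurable_fst.prodMk (measurable_const.min measurable_snd)))
    (isOpen_nearCompl D n).measurableSet.compl

theorem survives_add (D : Set (Space d)) (s t : ℝ≥0) :
    survives (d := d) D (s + t) = survives D s ∩ shift s ⁻¹' survives D t := by
  ext ω
  constructor
  · rintro ⟨n, hn⟩
    exact ⟨⟨n, fun r hr => hn r (hr.trans le_self_add)⟩,
      ⟨n, fun r hr => hn (s + r) (add_le_add_right hr s)⟩⟩
  · rintro ⟨⟨n, hn⟩, ⟨m, hm⟩⟩
    refine ⟨max n m, fun r hr hU => ?_⟩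
    rcases le_total r s with h | h
    · exact hn r h (nearCompl_antitone D (le_max_left n m) hU)
    · refine hm (r - s) (tsub_le_iff_left.2 hr) ?_
      change ω (s + (r - s)) ∈ _
      rw [add_tsub_cancel_of_le h]
      exact nearCompl_antitone D (le_max_right n m) hU

theorem path_mem_of_survives (h : ω ∈ survives D t) {r : ℝ≥0} (hr : r ≤ t) : ω r ∈ D := by
  obtain ⟨n, hn⟩ := h
  by_contra hc
  exact hn r hr (compl_subset_nearCompl D n hc)

theorem survives_of_lt_approachTime (h : t < approachTime D s ω) : ω ∈ survives D t := by
  obtain ⟨n, hn⟩ := exists_lt_of_lt_ciSup h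
  exact ⟨n, fun r hr => notMem_of_lt_entryBefore (hr.trans_lt hn)⟩

theorem lt_exitTime_of_survives (hD : IsOpen D) (h : ω ∈ survives D t) :
    (t : ℝ≥0∞) < exitTime D ω := by
  have h1 : ∀ᶠ q in 𝓝[≥] t, ω q ∈ D :=
    (ω.right_continuous t).eventually (hD.mem_nhds (path_mem_of_survives h le_rfl))
  obtain ⟨v, hv, hsub⟩ := (mem_nhdsGE_iff_exists_Ico_subset' (show t < t + 1 by simp)).1 h1
  refine lt_of_lt_of_le (ENNReal.coe_lt_coe.2 hv) (le_iInf₂ fun r hr => ?_)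
  by_contra hlt
  have hlt : r < v := by simpa using hlt
  rcases le_total r t with h2 | h2
  · exact hr.2 (path_mem_of_survives h h2)
  · exact hr.2 (hsub ⟨h2, hlt⟩)

theorem exitMin_coe : ((exitMin D t ω : ℝ≥0) : ℝ≥0∞) = min (exitTime D ω) t := by
  rw [exitMin, ENNReal.coe_toNNReal]
  exact ne_top_of_le_ne_top ENNReal.coe_ne_top (min_le_right _ _)

theorem approachTime_le_exitMin : approachTime D t ω ≤ exitMin D t ω := by
  rw [← ENNReal.coe_le_coe, exitMin_coe]
  refine le_min (le_iInf₂ fun r hr => ?_) (by exact_mod_cast approachTime_le)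
  by_contra hlt
  exact hr.2 (path_mem_of_lt_approachTime (by simpa using hlt))

/-- If the path starts in `D` and is outside `D` at the approach time (when
that is before `t`), then the approach time is the exit time truncated at `t`. -/
theorem exitMin_eq_approachTime (h0 : ω 0 ∈ D)
    (h : approachTime D t ω < t → ω (approachTime D t ω) ∉ D) :
    exitMin D t ω = approachTime D t ω := by
  refine le_antisymm ?_ approachTime_le_exitMin
  rw [← ENNReal.coe_le_coe, exitMin_coe]
  rcases approachTime_le.eq_or_lt with h1 | h1
  · rw [h1]
    exact min_le_right _ _
  · refine (min_le_left _ _).trans (iInf₂_le _ ⟨pos_iff_ne_zero.2 fun h2 => ?_, h h1⟩)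
    exact h h1 (h2 ▸ h0)

theorem measurable_indicator_integral {φ : Space d → ℝ} (hφ : Measurable φ)
    {T : CadlagPath d → ℝ≥0} (hT : Measurable T) :
    Measurable fun ω : CadlagPath d => ∫ r in Ioc (0 : ℝ) (T ω), φ (ω r.toNNReal) := by
  have h : ∀ ω : CadlagPath d, ∫ r in Ioc (0 : ℝ) (T ω), φ (ω r.toNNReal) =
      ∫ r, ({p : CadlagPath d × ℝ | p.2 ∈ Ioc (0 : ℝ) (T p.1)}.indicator
        fun p => φ (p.1 p.2.toNNReal)) (ω, r) := by
    intro ω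
    rw [← integral_indicator measurableSet_Ioc]
    rfl
  simp_rw [h]
  have hm : MeasurableSet {p : CadlagPath d × ℝ | p.2 ∈ Ioc (0 : ℝ) (T p.1)} :=
    (measurableSet_lt measurable_const measurable_snd).inter
      (measurableSet_le measurable_snd (measurable_coe_nnreal_real.comp (hT.comp measurable_fst)))
  exact (((hφ.comp measurable_path_real).indicator hm).stronglyMeasurable.integral_prod_right'
    (ν := volume)).measurable

end

/-! ### Optional stopping in continuous time -/

theorem gridTime_le_iff {n : ℕ} {a s : ℝ≥0} :
    gridTime n a ≤ s ↔ a < (⌊((n : ℝ≥0) + 1) * s⌋₊ : ℝ≥0) / ((n : ℝ≥0) + 1) := by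
  rw [gridTime, div_le_iff₀ (by positivity), lt_div_iff₀ (by positivity), mul_comm s, mul_comm a,
    ← Nat.floor_lt (by positivity), ← Nat.add_one_le_iff, Nat.le_floor_iff (by positivity)]
  push_cast
  rfl

/-- Optional stopping for a bounded optional time at which the martingale is a.s.
right-continuous. The time is approximated from above by times with countably many values, along
which the stopped martingale is uniformly integrable. -/
theorem integral_martingale_optional {Ω : Type*} {m0 : MeasurableSpace Ω} {μ : Measure Ω}
    [IsFiniteMeasure μ] {ℱ : Filtration ℝ≥0 m0} {M : ℝ≥0 → Ω → ℝ} (hM : Martingale M ℱ μ)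
    {T : Ω → ℝ≥0} {t : ℝ≥0} (hT : ∀ s, MeasurableSet[ℱ s] {ω | T ω < s}) (hTt : ∀ ω, T ω ≤ t)
    (hcont : ∀ᵐ ω ∂μ, ContinuousWithinAt (fun s => M s ω) (Icc (T ω) t) (T ω)) :
    Integrable (fun ω => M (T ω) ω) μ ∧ ∫ ω, M (T ω) ω ∂μ = ∫ ω, M 0 ω ∂μ := by
  let σ : ℕ → Ω → WithTop ℝ≥0 := fun n ω => ((min (gridTime n (T ω)) t : ℝ≥0) : WithTop ℝ≥0)
  have hle : ∀ n ω (s : ℝ≥0), σ n ω ≤ s ↔ min (gridTime n (T ω)) t ≤ s := fun n ω s =>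
    WithTop.coe_le_coe
  have hσ : ∀ n, IsStoppingTime ℱ (σ n) := by
    intro n s
    by_cases hts : t ≤ s
    · have : {ω | σ n ω ≤ s} = univ := by
        ext ω
        exact iff_of_true ((hle n ω s).2 (min_le_of_right_le hts)) (mem_univ _)
      rw [this]
      exact MeasurableSet.univ
    · have : {ω | σ n ω ≤ s} =
          {ω | T ω < (⌊((n : ℝ≥0) + 1) * s⌋₊ : ℝ≥0) / ((n : ℝ≥0) + 1)} := by
        ext ω
        exact (hle n ω s).trans (by simp [hts, gridTime_le_iff])
      rw [this]
      refine ℱ.mono ?_ _ (hT _)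
      rw [div_le_iff₀ (by positivity), mul_comm s]
      exact Nat.floor_le (by positivity)
  have hσt : ∀ n ω, σ n ω ≤ t := fun n ω => (hle n ω t).2 (min_le_right _ _)
  have hcount : ∀ n, (range (σ n)).Countable := by
    intro n
    refine (countable_range fun k : ℕ =>
      ((min (((k : ℝ≥0) + 1) / ((n : ℝ≥0) + 1)) t : ℝ≥0) : WithTop ℝ≥0)).mono ?_
    rintro _ ⟨ω, rfl⟩
    exact ⟨⌊((n : ℝ≥0) + 1) * T ω⌋₊, rfl⟩
  have hcond : ∀ n, stoppedValue M (σ n) =ᵐ[μ] μ[M t | (hσ n).measurableSpace] := fun n =>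
    hM.stoppedValue_ae_eq_condExp_of_le_const_of_countable_range (hσ n) (hσt n) (hcount n)
  have hUI : UniformIntegrable (fun n => stoppedValue M (σ n)) 1 μ :=
    ((hM.integrable t).uniformIntegrable_condExp
      (fun n => (hσ n).measurableSpace_le_of_le (hσt n))).ae_eq fun n => (hcond n).symm
  have hlim : ∀ᵐ ω ∂μ, Tendsto (fun n => stoppedValue M (σ n) ω) atTop (𝓝 (M (T ω) ω)) := by
    filter_upwards [hcont] with ω hω
    refine hω.tendsto.comp (tendsto_nhdsWithin_iff.2 ⟨?_, Eventually.of_forall fun n =>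
      ⟨le_min (lt_gridTime n _).le (hTt ω), min_le_right _ _⟩⟩)
    have := ((tendsto_nhdsWithin_iff.1 (tendsto_gridTime (T ω))).1).min
      (tendsto_const_nhds (x := t))
    rwa [min_eq_left (hTt ω)] at this
  have hmem : MemLp (fun ω => M (T ω) ω) 1 μ := hUI.memLp_of_ae_tendsto hlim
  have hL1 := tendsto_Lp_finite_of_tendsto_ae le_rfl ENNReal.one_ne_top hUI.1 hmem hUI.2.1 hlim
  have hint := tendsto_integral_of_L1' _ hmem.1
    (Eventually.of_forall fun n => memLp_one_iff_integrable.1 (hUI.memLp n)) hL1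
  refine ⟨memLp_one_iff_integrable.1 hmem, ?_⟩
  have h0 : ∫ ω, M 0 ω ∂μ = ∫ ω, M t ω ∂μ := by
    rw [← integral_congr_ae (hM.2 0 t zero_le), integral_condExp]
  rw [h0]
  refine tendsto_nhds_unique hint (tendsto_const_nhds.congr fun n => ?_)
  rw [integral_congr_ae (hcond n), integral_condExp]

/-! ### Dynkin's formula -/

theorem IsCb2.integrable_path {d : ℕ} {f : Space d → ℝ} (hf : IsCb2 f) {P : Measure (CadlagPath d)}
    [IsFiniteMeasure P] {T : CadlagPath d → ℝ≥0} (hT : Measurable T) :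
    Integrable (fun ω => f (ω (T ω))) P := by
  obtain ⟨C, hC⟩ := hf.2
  exact Integrable.of_bound (C := C)
    (hf.1.continuous.measurable.comp (measurable_path_at hT)).aestronglyMeasurable
    (Eventually.of_forall fun ω => (hC _).1)

theorem integral_stopped_sub {d : ℕ} {𝒜 : Coefficients d} {μ : Measure (Space d)}
    {P : Measure (CadlagPath d)} (hP : IsMartingaleSolution 𝒜 μ P) {f : Space d → ℝ}
    (hf : IsCb2 f) {T : CadlagPath d → ℝ≥0} {t : ℝ≥0}
    (hT : ∀ s, MeasurableSet[natFiltration d s] {ω | T ω < s}) (hTt : ∀ ω, T ω ≤ t) :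
    Integrable (fun ω => ∫ r in (0 : ℝ)..T ω, 𝒜.op f (ω r.toNNReal)) P ∧
      ∫ ω, f (ω (T ω)) ∂P - ∫ ω, f (ω 0) ∂P =
        ∫ ω, (∫ r in (0 : ℝ)..T ω, 𝒜.op f (ω r.toNNReal)) ∂P := by
  have := hP.isProbabilityMeasure
  obtain ⟨h1, h2⟩ := integral_martingale_optional (hP.martingale f hf) hT hTt (by
    filter_upwards [hP.integrable f hf t] with ω hω
    refine ContinuousWithinAt.sub (ContinuousWithinAt.sub ?_ continuousWithinAt_const) ?_
    · exact hf.1.continuous.continuousAt.comp_continuousWithinAt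
        ((ω.right_continuous (T ω)).mono Icc_subset_Ici_self)
    · have hc := intervalIntegral.continuousOn_primitive_interval' hω
        (left_mem_uIcc (a := (0 : ℝ)) (b := t)) (T ω)
        (by simpa [uIcc_of_le] using hTt ω)
      refine hc.comp NNReal.continuous_coe.continuousWithinAt fun s hs => ?_
      simpa [uIcc_of_le] using hs.2)
  have hfT := hf.integrable_path (P := P) (measurable_of_optional hT)
  have hf0 := hf.integrable_path (P := P) (measurable_const (a := (0 : ℝ≥0)))
  have h3 : ∀ ω, ∫ r in (0 : ℝ)..T ω, 𝒜.op f (ω r.toNNReal) =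
      f (ω (T ω)) - f (ω 0) - 𝒜.mart f (T ω) ω := fun ω => by simp [Coefficients.mart]
  have h4 : ∫ ω, 𝒜.mart f 0 ω ∂P = 0 := by simp [Coefficients.mart]
  refine ⟨((hfT.sub hf0).sub h1).congr (Eventually.of_forall fun ω => (h3 ω).symm), ?_⟩
  simp_rw [h3]
  have h5 := integral_sub (hfT.sub hf0) h1
  simp only [Pi.sub_apply] at h5
  rw [h5, integral_sub hfT hf0, h2, h4, sub_zero]

/-! ### The operator on test functions -/

section

variable {d : ℕ} {𝒜 : Coefficients d} {D : Set (Space d)} {f : Space d → ℝ}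

theorem isCb2_of_hasCompactSupport (hf : ContDiff ℝ 2 f) (hc : HasCompactSupport f) : IsCb2 f := by
  obtain ⟨C₀, h₀⟩ := hc.exists_bound_of_continuous hf.continuous
  obtain ⟨C₁, h₁⟩ := (hc.fderiv (𝕜 := ℝ)).exists_bound_of_continuous
    (hf.continuous_fderiv (by norm_num))
  obtain ⟨C₂, h₂⟩ := (hc.iteratedFDeriv (𝕜 := ℝ) 2).exists_bound_of_continuous
    (hf.continuous_iteratedFDeriv (m := 2) le_rfl)
  exact ⟨hf, max C₀ (max C₁ C₂), fun x => ⟨(h₀ x).trans (le_max_left _ _),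
    (h₁ x).trans ((le_max_left _ _).trans (le_max_right _ _)),
    (h₂ x).trans ((le_max_right _ _).trans (le_max_right _ _))⟩⟩

/-- The indicator of an open set is the pointwise limit of smooth functions with compact support
in that set. -/
theorem exists_test_functions {U : Set (Space d)} (hU : IsOpen U) :
    ∃ g : ℕ → Space d → ℝ, (∀ n, IsCb2 (g n)) ∧ (∀ n, IsCompact (tsupport (g n))) ∧
      (∀ n, tsupport (g n) ⊆ U) ∧ (∀ n x, g n x ∈ Icc (0 : ℝ) 1) ∧
      ∀ x ∈ U, ∀ᶠ n in atTop, g n x = 1 := by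
  let L : ℕ → Set (Space d) := fun n => (nearCompl U n)ᶜ ∩ Metric.closedBall 0 n
  have hL : ∀ n, IsCompact (L n) := fun n =>
    (isCompact_closedBall _ _).inter_left (isOpen_nearCompl U n).isClosed_compl
  have hLU : ∀ n, L n ⊆ U := fun n x hx => by
    by_contra hc
    exact hx.1 (compl_subset_nearCompl U n hc)
  have key : ∀ n, ∃ g : Space d → ℝ, IsCb2 g ∧ IsCompact (tsupport g) ∧ tsupport g ⊆ U ∧
      (∀ x, g x ∈ Icc (0 : ℝ) 1) ∧ ∀ x ∈ L n, g x = 1 := by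
    intro n
    obtain ⟨K, hK, hLK, hKU⟩ := exists_compact_between (hL n) hU (hLU n)
    obtain ⟨g, hg, hr, hs, h1⟩ := exists_contMDiff_support_eq_eq_one_iff (n := 2)
      (modelWithCornersSelf ℝ (Space d)) isOpen_interior (hL n).isClosed hLK
    have hts : tsupport g ⊆ K := closure_minimal (hs.subset.trans interior_subset) hK.isClosed
    have hc : HasCompactSupport g := hK.of_isClosed_subset isClosed_closure hts
    exact ⟨g, isCb2_of_hasCompactSupport hg.contDiff hc, hc, hts.trans hKU,
      fun x => hr (mem_range_self x), fun x hx => (h1 x).1 hx⟩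
  choose g h1 h2 h3 h4 h5 using key
  refine ⟨g, h1, h2, h3, h4, fun x hx => ?_⟩
  obtain ⟨m, hm⟩ := exists_notMem_closure_nearCompl hU hx
  obtain ⟨k, hk⟩ := exists_nat_ge ‖x‖
  filter_upwards [eventually_ge_atTop m, eventually_ge_atTop k] with n hn hn'
  refine h5 n x ⟨fun hc => hm n hn (subset_closure hc), ?_⟩
  rw [mem_closedBall_zero_iff]
  exact hk.trans (by exact_mod_cast hn')

/-- The second-order bound on the integrand of the jump part of the operator. -/
theorem exists_jump_integrand_bound (hf : IsCb2 f) : ∃ C, 0 ≤ C ∧ ∀ x y,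
    |f (x + y) - f x - fderiv ℝ f x y / (1 + ‖y‖ ^ 2)| ≤ C * min 1 (‖y‖ ^ 2) := by
  obtain ⟨hd, C, hC⟩ := hf
  have hC0 : 0 ≤ C := (abs_nonneg _).trans (hC 0).1
  refine ⟨3 * C, by positivity, fun x y => ?_⟩
  have hdy : ∀ z, |fderiv ℝ f z y| ≤ C * ‖y‖ := fun z =>
    ((fderiv ℝ f z).le_opNorm y).trans (by gcongr; exact (hC z).2.1)
  have hpos : 0 < 1 + ‖y‖ ^ 2 := by positivity
  rcases le_total ‖y‖ 1 with hy | hy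
  · have hy2 : ‖y‖ ^ 2 ≤ 1 := pow_le_one₀ (norm_nonneg _) hy
    rw [min_eq_right hy2]
    have hlip : ∀ z, ‖fderiv ℝ f z - fderiv ℝ f x‖ ≤ C * ‖z - x‖ := fun z =>
      Convex.norm_image_sub_le_of_norm_fderiv_le (𝕜 := ℝ) (s := univ)
        (fun w _ => (hd.fderiv_right (m := 1) (by norm_num)).differentiable (by norm_num) w)
        (fun w _ => by
          rw [← norm_iteratedFDeriv_one, norm_iteratedFDeriv_fderiv]
          exact (hC w).2.2) convex_univ (mem_univ _) (mem_univ _)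
    have h1 : ‖f (x + y) - f x - fderiv ℝ f x (x + y - x)‖ ≤ C * ‖y‖ * ‖x + y - x‖ := by
      refine Convex.norm_image_sub_le_of_norm_fderiv_le' (𝕜 := ℝ) (s := segment ℝ x (x + y))
        (fun w _ => hd.differentiable (by norm_num) w) (fun w hw => ?_) (convex_segment _ _)
        (left_mem_segment _ _ _) (right_mem_segment _ _ _)
      refine (hlip w).trans ?_
      gcongr
      simpa using norm_sub_le_of_mem_segment hw
    rw [add_sub_cancel_left, Real.norm_eq_abs] at h1
    have h2 : |fderiv ℝ f x y - fderiv ℝ f x y / (1 + ‖y‖ ^ 2)| ≤ C * ‖y‖ ^ 2 := by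
      have : fderiv ℝ f x y - fderiv ℝ f x y / (1 + ‖y‖ ^ 2) =
          fderiv ℝ f x y * (‖y‖ ^ 2 / (1 + ‖y‖ ^ 2)) := by field_simp; ring
      rw [this, abs_mul, abs_of_nonneg (a := ‖y‖ ^ 2 / (1 + ‖y‖ ^ 2)) (by positivity)]
      have h3 : ‖y‖ ^ 2 / (1 + ‖y‖ ^ 2) ≤ ‖y‖ ^ 2 :=
        div_le_self (by positivity) (by linarith [sq_nonneg ‖y‖])
      have h4 : |fderiv ℝ f x y| ≤ C := (hdy x).trans (mul_le_of_le_one_right hC0 hy)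
      exact mul_le_mul h4 h3 (by positivity) hC0
    have h5 := abs_add_le (f (x + y) - f x - fderiv ℝ f x y)
      (fderiv ℝ f x y - fderiv ℝ f x y / (1 + ‖y‖ ^ 2))
    rw [sub_add_sub_cancel] at h5
    nlinarith [mul_nonneg hC0 (sq_nonneg ‖y‖)]
  · rw [min_eq_left (one_le_pow₀ hy), mul_one]
    have h1 : |fderiv ℝ f x y / (1 + ‖y‖ ^ 2)| ≤ C := by
      rw [abs_div, abs_of_pos hpos, div_le_iff₀ hpos]
      refine (hdy x).trans ?_
      gcongr
      nlinarith
    have h2 := abs_sub (f (x + y) - f x) (fderiv ℝ f x y / (1 + ‖y‖ ^ 2))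
    have h3 := abs_sub (f (x + y)) (f x)
    linarith [(hC (x + y)).1, (hC x).1]

theorem exists_op_bound (hA1 : 𝒜.A1 D) (hA2 : 𝒜.A2) (hf : IsCb2 f) :
    ∃ C, ∀ x ∈ D, |𝒜.op f x| ≤ C := by
  obtain ⟨CQ, hQ⟩ := hA1.bounded_Q
  obtain ⟨Cb, hb⟩ := hA1.bounded_b
  obtain ⟨CJ, hJ0, hJ⟩ := exists_jump_integrand_bound hf
  obtain ⟨-, C, hC⟩ := hf
  have hC0 : 0 ≤ C := (abs_nonneg _).trans (hC 0).1
  set B := ⨆ x, ∫⁻ y, ENNReal.ofReal (min 1 (‖y‖ ^ 2)) ∂(𝒜.N x) with hB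
  refine ⟨(1 / 2) * ∑ _i : Fin d, ∑ _j : Fin d, CQ * C + C * Cb + CJ * B.toReal, fun x hx => ?_⟩
  refine (abs_add_le _ _).trans (add_le_add ((abs_add_le _ _).trans (add_le_add ?_ ?_)) ?_)
  · rw [abs_mul, abs_of_pos (by norm_num : (0 : ℝ) < 1 / 2)]
    gcongr
    refine (Finset.abs_sum_le_sum_abs _ _).trans (Finset.sum_le_sum fun i _ => ?_)
    refine (Finset.abs_sum_le_sum_abs _ _).trans (Finset.sum_le_sum fun j _ => ?_)
    rw [abs_mul]
    refine mul_le_mul (hQ x hx i j) ?_ (abs_nonneg _) ((abs_nonneg _).trans (hQ x hx i j))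
    refine ((iteratedFDeriv ℝ 2 f x).le_opNorm _).trans ?_
    simpa [Fin.prod_univ_two] using (hC x).2.2
  · refine ((fderiv ℝ f x).le_opNorm _).trans ?_
    exact mul_le_mul (hC x).2.1 (hb x hx) (norm_nonneg _) hC0
  · have h1 : ∫⁻ y, ENNReal.ofReal (CJ * min 1 (‖y‖ ^ 2)) ∂(𝒜.N x) ≤
        ENNReal.ofReal CJ * B := by
      simp_rw [ENNReal.ofReal_mul hJ0]
      rw [lintegral_const_mul' _ _ ENNReal.ofReal_ne_top]
      gcongr
      exact le_iSup (fun x => ∫⁻ y, ENNReal.ofReal (min 1 (‖y‖ ^ 2)) ∂(𝒜.N x)) x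
    have h2 := enorm_integral_le_lintegral_enorm (μ := 𝒜.N x)
      fun y => f (x + y) - f x - fderiv ℝ f x y / (1 + ‖y‖ ^ 2)
    have h3 := h2.trans ((lintegral_mono fun y => by
      rw [Real.enorm_eq_ofReal_abs]
      exact ENNReal.ofReal_le_ofReal (hJ x y)).trans h1)
    rw [Real.enorm_eq_ofReal_abs] at h3
    have h4 := ENNReal.toReal_mono (ENNReal.mul_ne_top ENNReal.ofReal_ne_top hA2.bounded_N.ne) h3
    rwa [ENNReal.toReal_ofReal (abs_nonneg _), ENNReal.toReal_mul, ENNReal.toReal_ofReal hJ0] at h4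

/-- Away from the support of `f` only the jump part of the operator is left. -/
theorem op_eq_of_notMem_tsupport {x : Space d} (hx : x ∉ tsupport f) :
    𝒜.op f x = ∫ y, f (x + y) ∂(𝒜.N x) := by
  have h0 : f x = 0 := image_eq_zero_of_notMem_tsupport hx
  have h1 : fderiv ℝ f x = 0 :=
    image_eq_zero_of_notMem_tsupport (f := fderiv ℝ f) fun h => hx (tsupport_fderiv_subset ℝ h)
  have h2 : iteratedFDeriv ℝ 2 f x = 0 :=
    image_eq_zero_of_notMem_tsupport (f := iteratedFDeriv ℝ 2 f)
      fun h => hx (tsupport_iteratedFDeriv_subset 2 h)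
  simp [Coefficients.op, h0, h1, h2]

/-- The jumps of size at least `1 / (k + 1)`. -/
def Coefficients.largeJumps (𝒜 : Coefficients d) (k : ℕ) : Kernel (Space d) (Space d) :=
  𝒜.N.restrict (s := {y | 1 / ((k : ℝ) + 1) ≤ ‖y‖})
    (measurableSet_le measurable_const measurable_norm)

theorem isFiniteKernel_largeJumps (hA2 : 𝒜.A2) (k : ℕ) : IsFiniteKernel (𝒜.largeJumps k) := by
  set B := ⨆ x, ∫⁻ y, ENNReal.ofReal (min 1 (‖y‖ ^ 2)) ∂(𝒜.N x) with hB
  set δ : ℝ := 1 / ((k : ℝ) + 1) with hδ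
  have hδ0 : 0 < δ := by positivity
  have hδ1 : 0 < min 1 (δ ^ 2) := by positivity
  refine ⟨⟨(ENNReal.ofReal (min 1 (δ ^ 2)))⁻¹ * B, ENNReal.mul_lt_top ?_ hA2.bounded_N,
    fun x => ?_⟩⟩
  · simpa using hδ1
  rw [Coefficients.largeJumps, Kernel.restrict_apply, Measure.restrict_apply_univ,
    ← ENNReal.div_eq_inv_mul, ENNReal.le_div_iff_mul_le (Or.inl (by simpa using hδ0.ne'))
      (Or.inl ENNReal.ofReal_ne_top), mul_comm]
  refine le_trans ?_ (le_iSup (fun x => ∫⁻ y, ENNReal.ofReal (min 1 (‖y‖ ^ 2)) ∂(𝒜.N x)) x)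
  refine le_trans ?_ (mul_meas_ge_le_lintegral (by fun_prop) (ENNReal.ofReal (min 1 (δ ^ 2))))
  gcongr with y
  intro hy
  gcongr

end

/-! ### The exit time is the approach time -/

section

variable {d : ℕ} {𝒜 : Coefficients d} {D : Set (Space d)} {x : Space d}
  {P : Measure (CadlagPath d)}

theorem IsMartingaleSolution.ae_path_zero (hP : IsMartingaleSolution 𝒜 (Measure.dirac x) P) :
    ∀ᵐ ω ∂P, ω 0 = x := by
  have h : ∀ᵐ z ∂(P.map fun ω : CadlagPath d => ω 0), z = x := by
    rw [hP.initial]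
    exact (ae_dirac_iff (measurableSet_singleton x)).2 rfl
  exact ae_of_ae_map (measurable_eval 0).aemeasurable h

theorem ae_forall_mem_Ioc_approachTime (D : Set (Space d)) (t : ℝ≥0) (ω : CadlagPath d) :
    ∀ᵐ r : ℝ, r ∈ Ioc (0 : ℝ) (approachTime D t ω) → ω r.toNNReal ∈ D := by
  have : ∀ᵐ r : ℝ, r ≠ approachTime D t ω := by simp [ae_iff]
  filter_upwards [this] with r hr h
  refine path_mem_of_lt_approachTime (t := t) ?_
  rw [Real.toNNReal_lt_iff_lt_coe h.1.le]
  exact lt_of_le_of_ne h.2 hr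

/-- Quasi-left-continuity at the boundary: when the path comes arbitrarily close to the complement
of `D`, it does not jump back into `D`. For a test function `g` supported in `D`, both sides of
Dynkin's formula are continuous along the entry times of the neighbourhoods of `Dᶜ`, while `g`
vanishes at these times. -/
theorem ae_path_approachTime_notMem (hD : IsOpen D) (hA1 : 𝒜.A1 D) (hA2 : 𝒜.A2)
    {μ : Measure (Space d)} (hP : IsMartingaleSolution 𝒜 μ P) (t : ℝ≥0) :
    ∀ᵐ ω ∂P, (∀ n, entryBefore (nearCompl D n) t ω < t) → ω (approachTime D t ω) ∉ D := by
  have := hP.isProbabilityMeasure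
  obtain ⟨g, hg, hgc, hgD, hg01, hg1⟩ := exists_test_functions hD
  set A : Set (CadlagPath d) := {ω | ∀ n, entryBefore (nearCompl D n) t ω < t} with hA
  have hAm : MeasurableSet A := by
    have : A = ⋂ n, {ω | entryBefore (nearCompl D n) t ω < t} := by
      ext
      simp [hA]
    rw [this]
    exact MeasurableSet.iInter fun n => (natFiltration d).le t _
      (measurableSet_entryBefore_lt (isOpen_nearCompl D n) t t)
  have key : ∀ j, ∀ᵐ ω ∂P, A.indicator (fun ω => g j (ω (approachTime D t ω))) ω = 0 := by
    intro j
    have hTn := fun n => integral_stopped_sub hP (hg j)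
      (fun s => measurableSet_entryBefore_lt (isOpen_nearCompl D n) t s) fun ω => entryBefore_le
    have hT := integral_stopped_sub hP (hg j) (measurableSet_approachTime_lt D t)
      fun ω => approachTime_le
    obtain ⟨C, hC⟩ := exists_op_bound hA1 hA2 (hg j)
    have hlim1 : Tendsto
        (fun n => ∫ ω, (∫ r in (0 : ℝ)..entryBefore (nearCompl D n) t ω,
          𝒜.op (g j) (ω r.toNNReal)) ∂P) atTop
        (𝓝 (∫ ω, (∫ r in (0 : ℝ)..approachTime D t ω, 𝒜.op (g j) (ω r.toNNReal)) ∂P)) := by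
      refine tendsto_integral_of_dominated_convergence (fun _ => |C| * t)
        (fun n => (hTn n).1.aestronglyMeasurable) (integrable_const _)
        (fun n => Eventually.of_forall fun ω => ?_) ?_
      · have hb : ∀ᵐ r : ℝ, r ∈ uIoc (0 : ℝ) (entryBefore (nearCompl D n) t ω) →
            ‖𝒜.op (g j) (ω r.toNNReal)‖ ≤ |C| := by
          filter_upwards [ae_forall_mem_Ioc_approachTime D t ω] with r hr h
          rw [uIoc_of_le (NNReal.coe_nonneg _)] at h
          exact (hC _ (hr ⟨h.1, h.2.trans (by exact_mod_cast entryBefore_le_approachTime n)⟩)).trans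
            (le_abs_self C)
        refine (intervalIntegral.norm_integral_le_of_norm_le_const_ae hb).trans ?_
        rw [sub_zero, abs_of_nonneg (NNReal.coe_nonneg _)]
        gcongr
        exact entryBefore_le
      · filter_upwards [hP.integrable (g j) (hg j) t] with ω hω
        have hc := intervalIntegral.continuousOn_primitive_interval' hω
          (left_mem_uIcc (a := (0 : ℝ)) (b := t)) (approachTime D t ω)
          (by simpa [uIcc_of_le] using approachTime_le)
        refine hc.tendsto.comp (tendsto_nhdsWithin_iff.2 ⟨?_, Eventually.of_forall fun n => ?_⟩)
        · exact (NNReal.continuous_coe.tendsto _).comp (tendsto_entryBefore D t ω)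
        · simpa [uIcc_of_le] using entryBefore_le
    have hlim2 : Tendsto (fun n => ∫ ω, g j (ω (entryBefore (nearCompl D n) t ω)) ∂P) atTop
        (𝓝 (∫ ω, g j (ω (approachTime D t ω)) ∂P)) := by
      have := hlim1.add_const (∫ ω, g j (ω 0) ∂P)
      rw [← hT.2, sub_add_cancel] at this
      refine this.congr fun n => ?_
      rw [← (hTn n).2, sub_add_cancel]
    -- On `A` the path is in the closure of the `n`-th neighbourhood at the entry time, where `g j`
    -- vanishes for large `n`; off `A` the entry times are eventually equal to `t`.
    have hlim3 : Tendsto (fun n => ∫ ω, g j (ω (entryBefore (nearCompl D n) t ω)) ∂P) atTop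
        (𝓝 (∫ ω, Aᶜ.indicator (fun ω => g j (ω (approachTime D t ω))) ω ∂P)) := by
      refine tendsto_integral_of_dominated_convergence (fun _ => (1 : ℝ)) (fun n =>
        ((hg j).integrable_path (measurable_of_optional fun s =>
          measurableSet_entryBefore_lt (isOpen_nearCompl D n) t s)).aestronglyMeasurable)
        (integrable_const _) (fun n => Eventually.of_forall fun ω => ?_)
        (Eventually.of_forall fun ω => ?_)
      · rw [Real.norm_eq_abs, abs_of_nonneg (hg01 j _).1]
        exact (hg01 j _).2
      · refine tendsto_const_nhds.congr' ?_
        by_cases hω : ω ∈ A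
        · rw [indicator_of_notMem (by simpa using hω)]
          obtain ⟨m, hm⟩ := exists_disjoint_closure_nearCompl hD (hgc j) (hgD j)
          filter_upwards [eventually_ge_atTop m] with n hn
          refine (image_eq_zero_of_notMem_tsupport fun h => ?_).symm
          exact disjoint_left.1 (hm n hn) h (path_entryBefore_mem_closure (hω n))
        · rw [indicator_of_mem (by simpa using hω)]
          obtain ⟨m, hm⟩ : ∃ m, t ≤ entryBefore (nearCompl D m) t ω := by
            simpa [hA] using hω
          filter_upwards [eventually_ge_atTop m] with n hn
          have h1 : entryBefore (nearCompl D n) t ω = t := le_antisymm entryBefore_le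
            (hm.trans (entryBefore_mono (nearCompl_antitone D hn)))
          have h2 : approachTime D t ω = t := le_antisymm approachTime_le
            (h1.symm.le.trans (entryBefore_le_approachTime n))
          rw [h1, h2]
    have hint := (hg j).integrable_path (P := P) (measurable_approachTime D t)
    have heq := tendsto_nhds_unique hlim2 hlim3
    rw [integral_indicator hAm.compl, ← integral_add_compl hAm hint, add_eq_right,
      ← integral_indicator hAm] at heq
    exact (integral_eq_zero_iff_of_nonneg (fun ω => indicator_nonneg (fun _ _ => (hg01 j _).1) ω)
      (hint.indicator hAm)).1 heq
  filter_upwards [ae_all_iff.2 key] with ω hω hωA hmem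
  obtain ⟨j, hj⟩ := (hg1 _ hmem).exists
  have := hω j
  rw [indicator_of_mem (by exact hωA), hj] at this
  exact one_ne_zero this

theorem ae_exitMin_eq_approachTime (hD : IsOpen D) (hA1 : 𝒜.A1 D) (hA2 : 𝒜.A2)
    (hx : x ∈ D) (hP : IsMartingaleSolution 𝒜 (Measure.dirac x) P) (t : ℝ≥0) :
    ∀ᵐ ω ∂P, exitMin D t ω = approachTime D t ω := by
  filter_upwards [hP.ae_path_zero, ae_path_approachTime_notMem hD hA1 hA2 hP t] with ω h0 h1
  exact exitMin_eq_approachTime (h0 ▸ hx) fun h =>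
    h1 fun n => (entryBefore_le_approachTime n).trans_lt h

theorem ae_survives_iff (hD : IsOpen D) (hA1 : 𝒜.A1 D) (hA2 : 𝒜.A2)
    (hx : x ∈ D) (hP : IsMartingaleSolution 𝒜 (Measure.dirac x) P) :
    ∀ᵐ ω ∂P, ∀ t : ℝ≥0, ω ∈ survives D t ↔ (t : ℝ≥0∞) < exitTime D ω := by
  filter_upwards [ae_all_iff.2 fun n : ℕ => ae_exitMin_eq_approachTime hD hA1 hA2 hx hP n]
    with ω h t
  refine ⟨lt_exitTime_of_survives hD, fun ht => ?_⟩
  obtain ⟨n, hn⟩ := exists_nat_gt t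
  refine survives_of_lt_approachTime (s := n) ?_
  rw [← h n, ← ENNReal.coe_lt_coe, exitMin_coe]
  exact lt_min ht (ENNReal.coe_lt_coe.2 hn)

/-! ### The exit position -/

/-- The expected occupation measure of the path before the approach time, which is truncated
at `t`. -/
def occupation (D : Set (Space d)) (t : ℝ≥0) (P : Measure (CadlagPath d)) : Measure (Space d) :=
  ((P.prod (volume.restrict (Ioc (0 : ℝ) t))).restrict
    {p | p.2 < approachTime D t p.1}).map fun p => p.1 p.2.toNNReal

instance isFiniteMeasure_occupation [IsFiniteMeasure P] (D : Set (Space d)) (t : ℝ≥0) :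
    IsFiniteMeasure (occupation D t P) := by
  unfold occupation
  infer_instance

theorem lintegral_occupation [IsFiniteMeasure P] (D : Set (Space d)) (t : ℝ≥0)
    {φ : Space d → ℝ≥0∞} (hφ : Measurable φ) :
    ∫⁻ y, φ y ∂(occupation D t P) =
      ∫⁻ ω, (∫⁻ r in Ioc (0 : ℝ) (approachTime D t ω), φ (ω r.toNNReal)) ∂P := by
  have hs : MeasurableSet {p : CadlagPath d × ℝ | p.2 < approachTime D t p.1} :=
    measurableSet_lt measurable_snd
      (measurable_coe_nnreal_real.comp ((measurable_approachTime D t).comp measurable_fst))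
  rw [occupation, lintegral_map hφ measurable_path_real, ← lintegral_indicator hs,
    lintegral_prod _ (by exact ((hφ.comp measurable_path_real).indicator hs).aemeasurable)]
  refine lintegral_congr fun ω => ?_
  rw [← lintegral_indicator measurableSet_Ioc, ← lintegral_indicator measurableSet_Ioc]
  have : ∀ᵐ r : ℝ, r ≠ approachTime D t ω := by simp [ae_iff]
  refine lintegral_congr_ae ?_
  filter_upwards [this] with r hr
  have hle : (approachTime D t ω : ℝ) ≤ t := by exact_mod_cast approachTime_le
  have hiff : (r ∈ Ioc (0 : ℝ) t ∧ r < approachTime D t ω) ↔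
      r ∈ Ioc (0 : ℝ) (approachTime D t ω) :=
    ⟨fun h => ⟨h.1.1, h.2.le⟩, fun h => ⟨⟨h.1, h.2.trans hle⟩, lt_of_le_of_ne h.2 hr⟩⟩
  by_cases h1 : r ∈ Ioc (0 : ℝ) (approachTime D t ω)
  · obtain ⟨h2, h3⟩ := hiff.2 h1
    simp only [indicator_of_mem h1, indicator_of_mem h2]
    exact indicator_of_mem (by exact h3) _
  · rw [indicator_of_notMem h1]
    by_cases h2 : r ∈ Ioc (0 : ℝ) t
    · rw [indicator_of_mem h2]
      exact indicator_of_notMem (s := {p : CadlagPath d × ℝ | p.2 < approachTime D t p.1})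
        (a := (ω, r)) (fun h3 => h1 (hiff.1 ⟨h2, h3⟩)) _
    · rw [indicator_of_notMem h2]

/-- The law of the exit position outside the closure of `D` is dominated by the expected number of
jumps, computed from the Lévy kernel along the occupation measure. -/
theorem measure_path_approachTime_mem_le (hA2 : 𝒜.A2) (hx : x ∈ D)
    (hP : IsMartingaleSolution 𝒜 (Measure.dirac x) P) (t : ℝ≥0) {k : ℕ} {Γ : Set (Space d)}
    (hΓ : IsOpen Γ) (hΓD : ∀ x ∈ D, ∀ y, x + y ∈ Γ → 1 / ((k : ℝ) + 1) ≤ ‖y‖) :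
    P {ω | ω (approachTime D t ω) ∈ Γ} ≤
      ∫⁻ x, 𝒜.largeJumps k x {y | x + y ∈ Γ} ∂(occupation D t P) := by
  have := hP.isProbabilityMeasure
  obtain ⟨g, hg, -, hgΓ, hg01, hg1⟩ := exists_test_functions hΓ
  set T := approachTime (d := d) D t with hT
  have hTm : Measurable T := measurable_approachTime D t
  have hdisj : ∀ j, ∀ x ∈ D, x ∉ tsupport (g j) := fun j x hx h => by
    have := hΓD x hx 0 (by simpa using hgΓ j h)
    rw [norm_zero] at this
    exact absurd this (not_le.2 (by positivity))
  -- On `D` the local part of the operator vanishes, and only jumps into `Γ` contribute.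
  have hop : ∀ j, ∀ x ∈ D, ‖𝒜.op (g j) x‖ₑ ≤ 𝒜.largeJumps k x {y | x + y ∈ Γ} := by
    intro j x hx
    have hm : MeasurableSet {y | x + y ∈ Γ} := hΓ.measurableSet.preimage (measurable_const_add x)
    rw [op_eq_of_notMem_tsupport (hdisj j x hx), Coefficients.largeJumps, Kernel.restrict_apply,
      Measure.restrict_apply hm,
      inter_eq_left.2 (show {y | x + y ∈ Γ} ⊆ {y | 1 / ((k : ℝ) + 1) ≤ ‖y‖} from hΓD x hx),
      ← lintegral_indicator_one hm]
    refine (enorm_integral_le_lintegral_enorm _).trans (lintegral_mono fun y => ?_)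
    by_cases hy : x + y ∈ Γ
    · rw [indicator_of_mem (by exact hy), Pi.one_apply, Real.enorm_eq_ofReal (hg01 j _).1]
      exact ENNReal.ofReal_le_one.2 (hg01 j _).2
    · simp [image_eq_zero_of_notMem_tsupport fun h => hy (hgΓ j h)]
  have := isFiniteKernel_largeJumps hA2 k
  have hmeas : Measurable fun x => 𝒜.largeJumps k x {y | x + y ∈ Γ} :=
    Kernel.measurable_kernel_prodMk_left (κ := 𝒜.largeJumps k)
      (t := {p : Space d × Space d | p.1 + p.2 ∈ Γ})
      (hΓ.measurableSet.preimage (measurable_fst.add measurable_snd))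
  have hbound : ∀ j, ∫⁻ ω, ENNReal.ofReal (g j (ω (T ω))) ∂P ≤
      ∫⁻ x, 𝒜.largeJumps k x {y | x + y ∈ Γ} ∂(occupation D t P) := by
    intro j
    have h0 : ∫ ω, g j (ω 0) ∂P = 0 := by
      refine integral_eq_zero_of_ae ?_
      filter_upwards [hP.ae_path_zero] with ω hω
      rw [hω]
      exact image_eq_zero_of_notMem_tsupport (hdisj j x hx)
    have h1 := (integral_stopped_sub hP (hg j) (measurableSet_approachTime_lt D t)
      fun ω => approachTime_le).2
    rw [h0, sub_zero] at h1
    rw [← ofReal_integral_eq_lintegral_ofReal ((hg j).integrable_path hTm)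
      (Eventually.of_forall fun ω => (hg01 j _).1), h1, lintegral_occupation D t hmeas]
    refine (Real.ofReal_le_enorm _).trans ((enorm_integral_le_lintegral_enorm _).trans
      (lintegral_mono fun ω => ?_))
    rw [intervalIntegral.integral_of_le (NNReal.coe_nonneg _)]
    refine (enorm_integral_le_lintegral_enorm _).trans (lintegral_mono_ae ?_)
    rw [ae_restrict_iff' measurableSet_Ioc]
    filter_upwards [ae_forall_mem_Ioc_approachTime D t ω] with r hr h
    exact hop j _ (hr h)
  have hset : MeasurableSet {ω : CadlagPath d | ω (T ω) ∈ Γ} :=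
    hΓ.measurableSet.preimage (measurable_path_at hTm)
  calc P {ω | ω (T ω) ∈ Γ}
      = ∫⁻ ω, {ω : CadlagPath d | ω (T ω) ∈ Γ}.indicator 1 ω ∂P :=
        (lintegral_indicator_one hset).symm
    _ ≤ ∫⁻ ω, liminf (fun j => ENNReal.ofReal (g j (ω (T ω)))) atTop ∂P := by
        refine lintegral_mono fun ω => ?_
        by_cases h : ω (T ω) ∈ Γ
        · rw [indicator_of_mem (by exact h)]
          refine le_liminf_of_le (by isBoundedDefault) ?_
          filter_upwards [hg1 _ h] with j hj
          simp [hj]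
        · rw [indicator_of_notMem (by exact h)]
          exact zero_le
    _ ≤ liminf (fun j => ∫⁻ ω, ENNReal.ofReal (g j (ω (T ω))) ∂P) atTop :=
        lintegral_liminf_le fun j => ((hg j).1.continuous.measurable.comp
          (measurable_path_at hTm)).ennreal_ofReal
    _ ≤ _ := (liminf_le_liminf (Eventually.of_forall hbound)).trans_eq (by simp)

/-- The pairs `(x, y)` with `y` in the support of `N x` form a measurable set. -/
theorem measurableSet_mem_support (𝒜 : Coefficients d) :
    MeasurableSet {p : Space d × Space d | p.2 ∈ (𝒜.N p.1).support} := by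
  have hB := TopologicalSpace.isBasis_countableBasis (Space d)
  have : {p : Space d × Space d | p.2 ∈ (𝒜.N p.1).support}ᶜ =
      ⋃ b ∈ TopologicalSpace.countableBasis (Space d), {x | 𝒜.N x b = 0} ×ˢ b := by
    ext p
    simp only [mem_compl_iff, mem_ofPred_eq, mem_iUnion, mem_prod, exists_prop]
    rw [Measure.notMem_support_iff_exists]
    constructor
    · rintro ⟨U, hU, h0⟩
      obtain ⟨b, hb, hpb, hbU⟩ := hB.mem_nhds_iff.1 hU
      exact ⟨b, hb, measure_mono_null hbU h0, hpb⟩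
    · rintro ⟨b, hb, h0, hpb⟩
      exact ⟨b, (hB.isOpen hb).mem_nhds hpb, h0⟩
  rw [← MeasurableSet.compl_iff, this]
  refine MeasurableSet.biUnion (TopologicalSpace.countable_countableBasis _) fun b hb => ?_
  have hbm := (hB.isOpen hb).measurableSet
  exact ((𝒜.N.measurable_coe hbm) (measurableSet_singleton 0)).prod hbm

/-- The path leaves `D` into its closure or into the range of non-locality. That range is a
projection of a measurable set, so its complement is reached through compact subsets of the set of
pairs of a position in `D` and an admissible jump. -/
theorem ae_path_approachTime_mem_extDomain (hD : IsOpen D) (hA2 : 𝒜.A2) (hx : x ∈ D)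
    (hP : IsMartingaleSolution 𝒜 (Measure.dirac x) P) (t : ℝ≥0) :
    ∀ᵐ ω ∂P, ω (approachTime D t ω) ∈ 𝒜.extDomain D := by
  have := hP.isProbabilityMeasure
  have hclos : closure D ⊆ 𝒜.extDomain D := by
    rw [closure_eq_self_union_frontier]
    exact union_subset subset_union_right (subset_union_left.trans subset_union_left)
  have hrange : 𝒜.range D ⊆ 𝒜.extDomain D := fun z hz => by
    by_cases h : z ∈ D
    · exact Or.inr h
    · exact Or.inl (Or.inr ⟨hz, h⟩)
  have key : ∀ k : ℕ, ∀ᵐ ω ∂P, ω (approachTime D t ω) ∈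
      Metric.cthickening (1 / ((k : ℝ) + 1)) D ∪ 𝒜.range D := by
    intro k
    have := isFiniteKernel_largeJumps hA2 k
    set J := (occupation D t P) ⊗ₘ (𝒜.largeJumps k) with hJ
    set H : Set (Space d × Space d) := {p | p.1 ∈ D ∧ p.2 ∈ (𝒜.N p.1).support} with hH
    have hHm : MeasurableSet H :=
      (hD.measurableSet.preimage measurable_fst).inter (measurableSet_mem_support 𝒜)
    have hocc : ∀ᵐ y ∂(occupation D t P), y ∈ D := by
      rw [ae_iff]
      change occupation D t P Dᶜ = 0
      rw [← lintegral_indicator_one hD.measurableSet.compl,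
        lintegral_occupation D t (measurable_one.indicator hD.measurableSet.compl)]
      refine (lintegral_congr fun ω => ?_).trans lintegral_zero
      refine (setLIntegral_congr_fun_ae measurableSet_Ioc ?_).trans lintegral_zero
      filter_upwards [ae_forall_mem_Ioc_approachTime D t ω] with r hr h
      simp [hr h]
    -- Almost every pair of a position and a large jump is in `H`.
    have hJH : J Hᶜ = 0 := by
      rw [hJ, Measure.compProd_apply hHm.compl]
      refine (lintegral_congr_ae ?_).trans lintegral_zero
      filter_upwards [hocc] with y hy
      refine measure_mono_null (t := (𝒜.N y).supportᶜ) (fun z hz h => hz ⟨hy, h⟩) ?_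
      rw [Coefficients.largeJumps, Kernel.restrict_apply]
      exact le_antisymm ((Measure.restrict_apply_le _ _).trans
        (Measure.measure_compl_support (μ := 𝒜.N y)).le) zero_le
    rw [ae_iff]
    refine le_antisymm (le_of_forall_pos_le_add fun ε hε => ?_) zero_le
    obtain ⟨K, hKH, hK, hJK⟩ := hHm.exists_isCompact_sdiff_lt (μ := J) (measure_ne_top _ _) hε.ne'
    have hJKc : J Kᶜ ≤ ε := by
      have : Kᶜ ⊆ Hᶜ ∪ H \ K := fun p hp => by
        by_cases h : p ∈ H
        · exact Or.inr ⟨h, hp⟩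
        · exact Or.inl h
      calc J Kᶜ ≤ J Hᶜ + J (H \ K) := (measure_mono this).trans (measure_union_le _ _)
        _ ≤ ε := by rw [hJH, zero_add]; exact hJK.le
    set C : Set (Space d) := (fun p : Space d × Space d => p.1 + p.2) '' K with hC
    have hCc : IsCompact C := hK.image (continuous_fst.add continuous_snd)
    have hCr : C ⊆ 𝒜.range D := by
      rintro _ ⟨p, hp, rfl⟩
      exact mem_biUnion (hKH hp).1 ⟨p.2, (hKH hp).2, rfl⟩
    set Γ : Set (Space d) := (Metric.cthickening (1 / ((k : ℝ) + 1)) D)ᶜ ∩ Cᶜ with hΓdef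
    have hΓ : IsOpen Γ := Metric.isClosed_cthickening.isOpen_compl.inter hCc.isClosed.isOpen_compl
    have hle := measure_path_approachTime_mem_le hA2 hx hP t (k := k) hΓ (fun z hz y hy => by
      by_contra hlt
      refine hy.1 (Metric.mem_cthickening_of_dist_le _ z _ _ hz ?_)
      simpa using (not_le.1 hlt).le)
    rw [zero_add]
    have hsub : {ω : CadlagPath d | ¬ ω (approachTime D t ω) ∈
        Metric.cthickening (1 / ((k : ℝ) + 1)) D ∪ 𝒜.range D} ⊆
          {ω | ω (approachTime D t ω) ∈ Γ} := fun ω hω =>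
      ⟨fun h => hω (Or.inl h), fun h => hω (Or.inr (hCr h))⟩
    refine (measure_mono hsub).trans (hle.trans (le_trans ?_ hJKc))
    have hm : MeasurableSet {p : Space d × Space d | p.1 + p.2 ∈ Γ} :=
      hΓ.measurableSet.preimage (measurable_fst.add measurable_snd)
    have hcomp := Measure.compProd_apply (μ := occupation D t P) (κ := 𝒜.largeJumps k) hm
    refine (hcomp.symm.le).trans (measure_mono fun p hp hpK => hp.2 ⟨p, hpK, rfl⟩)
  filter_upwards [ae_all_iff.2 key] with ω hω
  by_cases hc : ω (approachTime D t ω) ∈ closure D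
  · exact hclos hc
  · obtain ⟨δ, hδ, hdis⟩ := (disjoint_singleton_left.2 hc).exists_cthickenings
      isCompact_singleton isClosed_closure
    obtain ⟨k, hk⟩ := exists_nat_one_div_lt hδ
    refine hrange ((hω k).resolve_left fun h => ?_)
    refine disjoint_left.1 hdis (Metric.self_subset_cthickening _ rfl) ?_
    exact Metric.cthickening_mono hk.le _
      (Metric.cthickening_subset_of_subset _ subset_closure h)

end

/-! ### The discounted semigroup of the process killed outside `D` -/

section

variable {d : ℕ} {D : Set (Space d)} {P : Kernel (Space d) (CadlagPath d)} {α : ℝ}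
  {w : Space d → ℝ≥0∞} {x : Space d}

/-- `e^{-αt} E_x[w(X_t)]` on the event that the path survives in `D` up to time `t`, for `w` with
values in `[0, ∞]`. -/
def killed (P : Kernel (Space d) (CadlagPath d)) (D : Set (Space d)) (α : ℝ) (t : ℝ≥0)
    (w : Space d → ℝ≥0∞) (x : Space d) : ℝ≥0∞ :=
  ENNReal.ofReal (Real.exp (-α * t)) * ∫⁻ ω in survives D t, w (ω t) ∂(P x)

theorem measurable_killed (P : Kernel (Space d) (CadlagPath d)) (D : Set (Space d)) (α : ℝ)
    (t : ℝ≥0) (hw : Measurable w) : Measurable (killed P D α t w) := by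
  unfold killed
  simp_rw [← lintegral_indicator (measurableSet_survives D t)]
  exact (((hw.comp (measurable_eval t)).indicator
    (measurableSet_survives D t)).lintegral_kernel).const_mul _

theorem measurable_survives_indicator (D : Set (Space d)) (hw : Measurable w) :
    Measurable fun p : CadlagPath d × ℝ≥0 => (survives D p.2).indicator (fun ω => w (ω p.2)) p.1 :=
  (hw.comp measurable_path).indicator (measurableSet_survives_prod D)

theorem measurable_killed_time [SFinite (P x)] (hw : Measurable w) :
    Measurable fun t => killed P D α t w x := by
  unfold killed
  simp_rw [← lintegral_indicator (measurableSet_survives D _)]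
  refine Measurable.mul (by fun_prop) ?_
  exact (measurable_survives_indicator D hw).lintegral_prod_left'

/-- The Markov property at a fixed time, for functions of the path. -/
theorem IsStrongMarkov.lintegral_shift (hP : IsStrongMarkov P) (x : Space d) (s : ℝ≥0)
    {Λ : Set (CadlagPath d)} (hΛ : MeasurableSet[natFiltration d s] Λ) {φ : CadlagPath d → ℝ≥0∞}
    (hφ : Measurable φ) :
    ∫⁻ ω in Λ, φ (shift s ω) ∂(P x) = ∫⁻ ω in Λ, (∫⁻ ω', φ ω' ∂(P (ω s))) ∂(P x) := by
  have h : ((P x).restrict Λ).map (shift s) =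
      (((P x).restrict Λ).map fun ω => ω s).bind P := by
    ext B hB
    have hst := isStoppingTime_const (natFiltration d) s
    have hM := hP x _ hst Λ (by rwa [IsStoppingTime.measurableSpace_const]) B hB
    rw [Measure.map_apply (measurable_shift s) hB,
      Measure.restrict_apply (measurable_shift s hB),
      Measure.bind_apply hB P.measurable.aemeasurable,
      lintegral_map (P.measurable_coe hB) (measurable_eval s)]
    simp only [ne_eq, WithTop.coe_ne_top, not_false_eq_true, WithTop.untopD_coe, true_and,
      ofPred_true, inter_univ] at hM
    rw [← hM, inter_comm]
    rfl
  calc ∫⁻ ω in Λ, φ (shift s ω) ∂(P x)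
      = ∫⁻ ω, φ ω ∂(((P x).restrict Λ).map (shift s)) := (lintegral_map hφ (measurable_shift s)).symm
    _ = _ := by
      rw [h, Measure.lintegral_bind P.measurable.aemeasurable hφ.aemeasurable,
        lintegral_map hφ.lintegral_kernel (measurable_eval s)]

theorem killed_killed (hP : IsStrongMarkov P) (s t : ℝ≥0) (hw : Measurable w) (x : Space d) :
    killed P D α s (killed P D α t w) x = killed P D α (s + t) w x := by
  have h1 := hP.lintegral_shift x s (measurableSet_survives_natFiltration D s)
    ((hw.comp (measurable_eval t)).indicator (measurableSet_survives D t))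
  simp_rw [lintegral_indicator (measurableSet_survives D t)] at h1
  simp only [killed]
  rw [lintegral_const_mul' _ _ ENNReal.ofReal_ne_top, ← mul_assoc,
    ← ENNReal.ofReal_mul (Real.exp_nonneg _), ← Real.exp_add]
  have h2 : ∫⁻ ω in survives D s, (∫⁻ ω' in survives D t, w (ω' t) ∂(P (ω s))) ∂(P x) =
      ∫⁻ ω in survives D (s + t), w (ω (s + t)) ∂(P x) := by
    rw [survives_add, inter_comm,
      ← Measure.restrict_restrict (measurable_shift s (measurableSet_survives D t)),
      ← lintegral_indicator (measurable_shift s (measurableSet_survives D t))]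
    exact h1.symm
  rw [h2]
  congr 3
  push_cast
  ring

theorem killed_sub_add_killed (hP : IsStrongMarkov P) (hw : Measurable w)
    (hsm : ∀ t, ∀ x ∈ D, killed P D α t w x ≤ w x) (s t : ℝ≥0) (x : Space d) :
    killed P D α s (fun y => w y - killed P D α t w y) x + killed P D α (s + t) w x =
      killed P D α s w x := by
  rw [← killed_killed hP s t hw]
  simp only [killed]
  rw [← mul_add, ← lintegral_add_right]
  · congr 1
    refine setLIntegral_congr_fun (measurableSet_survives D s) fun ω hω => ?_
    exact tsub_add_cancel_of_le (hsm t _ (path_mem_of_survives hω le_rfl))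
  · exact (measurable_killed P D α t hw).comp (measurable_eval s)

/-- The potential of `w - P_t w` is at most `t w` for a supermedian function `w`: the time integral
of `P_s w - P_{s+t} w` telescopes. -/
theorem lintegral_killed_sub_le [SFinite (P x)] (hP : IsStrongMarkov P) (hw : Measurable w)
    (hsm : ∀ t, ∀ x ∈ D, killed P D α t w x ≤ w x) (hx : x ∈ D) (hwx : w x ≠ ⊤) (t : ℝ≥0) :
    ∫⁻ s in Ioi (0 : ℝ), killed P D α s.toNNReal (fun y => w y - killed P D α t w y) x ≤
      t * w x := by
  set q : ℝ → ℝ≥0∞ := fun r => killed P D α r.toNNReal w x with hq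
  set φ : ℝ → ℝ≥0∞ := fun s => killed P D α s.toNNReal (fun y => w y - killed P D α t w y) x
  have hqm : Measurable q := (measurable_killed_time hw).comp measurable_real_toNNReal
  have hqw : ∀ r, q r ≤ w x := fun r => hsm _ x hx
  have hint : ∀ a b : ℝ, ∫⁻ r in Ioc a b, q r ≤ w x * ENNReal.ofReal (b - a) := fun a b => by
    refine (setLIntegral_mono measurable_const fun r _ => hqw r).trans_eq ?_
    rw [setLIntegral_const, Real.volume_Ioc]
  have hfin : ∀ k : ℕ, ∫⁻ s in Ioc (0 : ℝ) k, φ s ≤ t * w x := by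
    intro k
    have h1 : (∫⁻ s in Ioc (0 : ℝ) k, φ s) + ∫⁻ s in Ioc (0 : ℝ) k, q (s + t) =
        ∫⁻ s in Ioc (0 : ℝ) k, q s := by
      rw [← lintegral_add_right _ (by exact hqm.comp (measurable_add_const _))]
      refine setLIntegral_congr_fun measurableSet_Ioc fun s hs => ?_
      have : (s + t).toNNReal = s.toNNReal + t := by
        rw [Real.toNNReal_add hs.1.le (NNReal.coe_nonneg t), Real.toNNReal_coe]
      simp only [hq, this]
      exact killed_sub_add_killed hP hw hsm _ t x
    have h2 : ∫⁻ s in Ioc (0 : ℝ) k, q (s + t) = ∫⁻ s in Ioc (t : ℝ) (k + t), q s := by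
      have := (measurePreserving_add_right volume (t : ℝ)).setLIntegral_comp_preimage
        (measurableSet_Ioc (a := (t : ℝ)) (b := k + t)) hqm
      rw [← this]
      simp
    have h3 : ∫⁻ s in Ioc (0 : ℝ) k, q s ≤
        (∫⁻ s in Ioc (0 : ℝ) t, q s) + ∫⁻ s in Ioc (t : ℝ) (k + t), q s := by
      refine (lintegral_mono_set fun s hs => ?_).trans (lintegral_union_le _ _ _)
      rcases le_total s t with h | h
      · exact Or.inl ⟨hs.1, h⟩
      · rcases h.eq_or_lt with rfl | h
        · exact Or.inl ⟨hs.1, le_rfl⟩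
        · exact Or.inr ⟨h, hs.2.trans (by simp)⟩
    rw [← h1, h2] at h3
    have h4 : ∫⁻ s in Ioc (t : ℝ) (k + t), q s ≠ ⊤ :=
      ne_top_of_le_ne_top (ENNReal.mul_ne_top hwx ENNReal.ofReal_ne_top) (hint _ _)
    refine ((ENNReal.add_le_add_iff_right h4).1 h3).trans ((hint 0 t).trans_eq ?_)
    rw [sub_zero, ENNReal.ofReal_coe_nnreal, mul_comm]
  have hU : Ioi (0 : ℝ) = ⋃ k : ℕ, Ioc (0 : ℝ) k := by
    ext s
    simp only [mem_Ioi, mem_iUnion, mem_Ioc, exists_and_left, iff_self_and]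
    exact fun _ => exists_nat_ge s
  rw [hU, setLIntegral_iUnion_of_directed]
  · exact iSup_le hfin
  · exact (monotone_nat_of_le_succ fun k => Ioc_subset_Ioc_right (by simp)).directed_le

theorem resolvent_le_lintegral_killed [SFinite (P x)] {f : Space d → ℝ≥0∞} (hf : Measurable f)
    (hf' : ∀ y, f y ≠ ⊤)
    (hsurv : ∀ᵐ ω ∂(P x), ∀ t : ℝ≥0, ω ∈ survives D t ↔ (t : ℝ≥0∞) < exitTime D ω) :
    resolvent P D α (fun y => (f y).toReal) x ≤
      ∫⁻ s in Ioi (0 : ℝ), killed P D α s.toNNReal f x := by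
  have hm : Measurable fun p : CadlagPath d × ℝ =>
      ENNReal.ofReal (Real.exp (-α * p.2.toNNReal)) *
        (survives D p.2.toNNReal).indicator (fun ω => f (ω p.2.toNNReal)) p.1 := by
    refine Measurable.mul (by fun_prop) ((measurable_survives_indicator D hf).comp
      (measurable_fst.prodMk (measurable_real_toNNReal.comp measurable_snd)))
  calc resolvent P D α (fun y => (f y).toReal) x
      ≤ ∫⁻ ω, (∫⁻ s in Ioi (0 : ℝ), ENNReal.ofReal (Real.exp (-α * s.toNNReal)) *
        (survives D s.toNNReal).indicator (fun ω => f (ω s.toNNReal)) ω) ∂(P x) := by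
        refine lintegral_mono_ae ?_
        filter_upwards [hsurv] with ω hω
        have hset : MeasurableSet {t : ℝ | 0 < t ∧ ENNReal.ofReal t < exitTime D ω} :=
          measurableSet_Ioi.inter (measurableSet_lt ENNReal.measurable_ofReal measurable_const)
        rw [← lintegral_indicator hset, ← lintegral_indicator measurableSet_Ioi]
        refine lintegral_mono fun s => ?_
        by_cases hs : s ∈ {t : ℝ | 0 < t ∧ ENNReal.ofReal t < exitTime D ω}
        · rw [indicator_of_mem hs, indicator_of_mem (by exact hs.1),
            indicator_of_mem ((hω s.toNNReal).2 hs.2), ENNReal.ofReal_mul (Real.exp_nonneg _),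
            ENNReal.ofReal_toReal (hf' _), Real.coe_toNNReal _ hs.1.le]
        · rw [indicator_of_notMem hs]
          exact zero_le
    _ = ∫⁻ s in Ioi (0 : ℝ), (∫⁻ ω, ENNReal.ofReal (Real.exp (-α * s.toNNReal)) *
        (survives D s.toNNReal).indicator (fun ω => f (ω s.toNNReal)) ω ∂(P x)) :=
        lintegral_lintegral_swap hm.aemeasurable
    _ = _ := by
        refine lintegral_congr fun s => ?_
        rw [lintegral_const_mul' _ _ ENNReal.ofReal_ne_top,
          lintegral_indicator (measurableSet_survives D _)]
        rfl

/-- A bounded function that is not decreased by the killed semigroup vanishes, because the process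
leaves `D` in finite time. -/
theorem eq_zero_of_le_killed [IsFiniteMeasure (P x)] (hα : 0 ≤ α) (hD : IsOpen D) {C : ℝ≥0∞}
    (hC : C ≠ ⊤) (hwC : ∀ y, w y ≤ C) (hET : ∀ᵐ ω ∂(P x), exitTime D ω < ⊤)
    (h : ∀ n : ℕ, w x ≤ killed P D α n w x) : w x = 0 := by
  have hbound : ∀ n : ℕ, w x ≤ C * P x (survives D n) := by
    intro n
    refine (h n).trans ?_
    have h1 : ENNReal.ofReal (Real.exp (-α * (n : ℝ≥0))) ≤ 1 := by
      rw [ENNReal.ofReal_le_one, Real.exp_le_one_iff]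
      exact mul_nonpos_of_nonpos_of_nonneg (neg_nonpos.2 hα) (NNReal.coe_nonneg _)
    refine (mul_le_of_le_one_left zero_le h1).trans ?_
    refine (lintegral_mono fun ω => hwC _).trans_eq ?_
    rw [lintegral_const, Measure.restrict_apply_univ]
  have hlim : Tendsto (fun n : ℕ => P x (survives D n)) atTop
      (𝓝 (P x (⋂ n : ℕ, survives D n))) := by
    refine tendsto_measure_iInter_atTop
      (fun n => (measurableSet_survives D _).nullMeasurableSet) ?_ ⟨0, measure_ne_top _ _⟩
    rintro m n hmn ω ⟨k, hk⟩
    exact ⟨k, fun r hr => hk r (hr.trans (by exact_mod_cast hmn))⟩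
  have h0 : P x (⋂ n : ℕ, survives D n) = 0 := by
    refine measure_mono_null (fun ω hω => ?_) (ae_iff.1 hET)
    rw [mem_iInter] at hω
    simp only [mem_ofPred_eq, not_lt, top_le_iff]
    by_contra h_fin
    obtain ⟨n, hn⟩ := ENNReal.exists_nat_gt h_fin
    exact lt_asymm hn (by simpa using lt_exitTime_of_survives hD (hω n))
  rw [h0] at hlim
  have := ENNReal.Tendsto.const_mul hlim (Or.inr hC)
  rw [mul_zero] at this
  exact le_antisymm (ge_of_tendsto' this hbound) zero_le

/-! ### Lower bound for supermedian functions -/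

/-- The Hopf lemma for a bounded function that is supermedian for the discounted killed semigroup:
it dominates the potentials of the functions `(w - P_n w) / n`, and at least one of these functions
has a positive integral against the minorizing measure. -/
theorem exists_mul_le_of_supermedian {𝒜 : Coefficients d} (hD : IsOpen D)
    (hA1 : 𝒜.A1 D) (hA2 : 𝒜.A2) (hP : IsStrongMarkovSolution 𝒜 P) (hET : ExitFinite P D)
    (hα : 0 ≤ α) {ψ : Space d → ℝ} {ν : Measure D} (hM : Minorization P D α ψ ν)
    (hw : Measurable w) {C : ℝ≥0∞} (hC : C ≠ ⊤) (hwC : ∀ y, w y ≤ C)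
    (hsm : ∀ t, ∀ x ∈ D, killed P D α t w x ≤ w x) (hw0 : ¬ ∀ᵐ y : D ∂ν, w y = 0) :
    ∃ a : ℝ, 0 < a ∧ ∀ x ∈ D, ENNReal.ofReal (a * ψ x) ≤ w x := by
  have hprob : ∀ x, IsProbabilityMeasure (P x) := fun x => (hP.solution x).isProbabilityMeasure
  set f : ℕ → Space d → ℝ≥0∞ := fun n y => w y - killed P D α n w y with hf
  have hfm : ∀ n, Measurable (f n) := fun n => hw.sub (measurable_killed P D α n hw)
  have hfC : ∀ n y, f n y ≤ C := fun n y => tsub_le_self.trans (hwC y)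
  have hf' : ∀ n y, f n y ≠ ⊤ := fun n y => ne_top_of_le_ne_top hC (hfC n y)
  obtain ⟨n, hn⟩ : ∃ n, ∫⁻ y : D, f n y ∂ν ≠ 0 := by
    by_contra! hall
    refine hw0 ?_
    have h1 : ∀ n, ∀ᵐ y : D ∂ν, f n y = 0 := fun n =>
      (lintegral_eq_zero_iff ((hfm n).comp measurable_subtype_coe)).1 (hall n)
    filter_upwards [ae_all_iff.2 h1] with y hy
    exact eq_zero_of_le_killed hα hD hC hwC (hET y y.2) fun n => tsub_eq_zero_iff_le.1 (hy n)
  set I := ∫⁻ y : D, f n y ∂ν with hI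
  have hmin : ∀ x ∈ D, ENNReal.ofReal (ψ x) * I ≤ (n + 1) * w x := by
    intro x hx
    have h1 := hM (fun y => (f n y).toReal)
      ⟨((hfm n).comp measurable_subtype_coe).ennreal_toReal, fun y _ => ENNReal.toReal_nonneg,
        C.toReal, fun y _ => ENNReal.toReal_mono hC (hfC n y)⟩ x hx
    simp only [ENNReal.ofReal_toReal (hf' n _)] at h1
    refine h1.trans ((resolvent_le_lintegral_killed (hfm n) (hf' n)
      (ae_survives_iff hD hA1 hA2 hx (hP.solution x))).trans
      ((lintegral_killed_sub_le hP.strongMarkov hw hsm hx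
        (ne_top_of_le_ne_top hC (hwC x)) n).trans ?_))
    gcongr
    simp
  -- The integral `I` may be infinite, hence the truncation.
  have hI1 : min I 1 ≠ ⊤ := ne_top_of_le_ne_top ENNReal.one_ne_top (min_le_right _ _)
  refine ⟨(min I 1).toReal / (n + 1), div_pos (ENNReal.toReal_pos ?_ hI1) (by positivity), ?_⟩
  · exact (lt_min (pos_iff_ne_zero.2 hn) one_pos).ne'
  intro x hx
  have h1 : (min I 1).toReal / (n + 1) * ψ x = (ψ x * (min I 1).toReal) / (n + 1) := by ring
  rw [h1, ENNReal.ofReal_div_of_pos (by positivity), ENNReal.ofReal_mul' ENNReal.toReal_nonneg,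
    ENNReal.ofReal_toReal hI1]
  refine ENNReal.div_le_of_le_mul' ?_
  refine (mul_le_mul_right (min_le_left I 1) _).trans ((hmin x hx).trans_eq ?_)
  congr 1
  rw [ENNReal.ofReal_add (by positivity) zero_le_one, ENNReal.ofReal_natCast, ENNReal.ofReal_one]

/-! ### Weak subsolutions -/

/-- If `u` is a weak subsolution bounded by `k ≥ 0` on `D` and on its extended boundary, then
`k - u` is supermedian for the semigroup killed outside `D` and discounted at rate `sup_D c`. -/
theorem IsWeakSubsolution.killed_le {𝒜 : Coefficients d} (hD : IsOpen D)
    (hA1 : 𝒜.A1 D) (hA2 : 𝒜.A2) (hP : IsStrongMarkovSolution 𝒜 P)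
    {c g u : Space d → ℝ} (hc : IsBddBorelNonnegOn D c) (hu : IsWeakSubsolution P D c g u)
    (hα : ∀ x ∈ D, c x ≤ α) {k : ℝ} (hk : 0 ≤ k) (huk : ∀ x ∈ 𝒜.extDomain D, u x ≤ k)
    (t : ℝ≥0) (hx : x ∈ D) :
    killed P D α t (D.indicator fun y => ENNReal.ofReal (k - u y)) x ≤
      D.indicator (fun y => ENNReal.ofReal (k - u y)) x := by
  have hsol := hP.solution x
  have := hsol.isProbabilityMeasure
  have hα0 : 0 ≤ α := (hc.nonneg x hx).trans (hα x hx)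
  obtain ⟨C, hC⟩ := hu.bounded
  set T := approachTime (d := d) D t with hT
  have hTm : Measurable T := measurable_approachTime D t
  -- `c` is measurable only on `D`, so it is cut off outside `D`.
  set e : CadlagPath d → ℝ := fun ω =>
    Real.exp (-∫ r in Ioc (0 : ℝ) (T ω), D.indicator c (ω r.toNNReal)) with he
  have hcm : Measurable (D.indicator c) := by
    refine measurable_of_restrict_of_restrict_compl hD.measurableSet ?_ ?_
    · convert hc.measurable using 1
      exact funext fun y => indicator_of_mem y.2 c
    · convert measurable_const (a := (0 : ℝ)) using 1
      exact funext fun y => indicator_of_notMem y.2 c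
  have hem : Measurable e := (measurable_indicator_integral hcm hTm).neg.exp
  have hc0 : ∀ y, 0 ≤ D.indicator c y := fun y => indicator_nonneg hc.nonneg y
  have hcα : ∀ y, D.indicator c y ≤ α := fun y => indicator_apply_le' (hα y) fun _ => hα0
  have he1 : ∀ ω, e ω ≤ 1 := fun ω => by
    rw [he, Real.exp_le_one_iff, neg_nonpos]
    exact integral_nonneg fun r => hc0 _
  have heα : ∀ ω, Real.exp (-α * t) ≤ e ω := fun ω => by
    rw [he, Real.exp_le_exp, neg_mul, neg_le_neg_iff]
    have h1 := norm_setIntegral_le_of_norm_le_const (μ := volume) (s := Ioc (0 : ℝ) (T ω))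
      (f := fun r => D.indicator c (ω r.toNNReal)) (C := α) measure_Ioc_lt_top fun r _ => by
        rw [Real.norm_of_nonneg (hc0 _)]
        exact hcα _
    refine (le_abs_self _).trans (h1.trans ?_)
    rw [Real.volume_real_Ioc_of_le (NNReal.coe_nonneg _), sub_zero]
    gcongr
    exact approachTime_le
  -- The integrand in the subsolution inequality agrees almost surely with a measurable function,
  -- so that its Bochner integral has its intended value.
  have hF : (fun ω => expWeight c (exitMin D t ω) ω * u (ω (exitMin D t ω))) =ᵐ[P x]
      fun ω => e ω * u (ω (T ω)) := by
    filter_upwards [ae_exitMin_eq_approachTime hD hA1 hA2 hx hsol t] with ω hω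
    rw [hω, expWeight, intervalIntegral.integral_of_le (NNReal.coe_nonneg _)]
    congr 3
    refine setIntegral_congr_ae measurableSet_Ioc ?_
    filter_upwards [ae_forall_mem_Ioc_approachTime D t ω] with r hr h
    rw [indicator_of_mem (hr h)]
  have hint : Integrable (fun ω => e ω * u (ω (T ω))) (P x) := by
    refine Integrable.of_bound (C := |C|)
      (hem.mul (hu.measurable.comp (measurable_path_at hTm))).aestronglyMeasurable
      (Eventually.of_forall fun ω => ?_)
    rw [norm_mul, Real.norm_of_nonneg (Real.exp_nonneg _), Real.norm_eq_abs]
    exact (mul_le_of_le_one_left (abs_nonneg _) (he1 ω)).trans ((hC _).trans (le_abs_self C))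
  have hux : u x ≤ ∫ ω, e ω * u (ω (T ω)) ∂(P x) := by
    have h1 := hu.le_expectation x hx t
    rw [integral_congr_ae hF] at h1
    have h2 := h1.trans (EReal.sub_le_sub le_rfl
      (EReal.coe_ennreal_nonneg (sourceTerm P D c g x t)))
    rw [sub_zero] at h2
    exact_mod_cast h2
  have hext := ae_path_approachTime_mem_extDomain hD hA2 hx hsol t
  have hnn : ∀ᵐ ω ∂(P x), 0 ≤ k - e ω * u (ω (T ω)) := by
    filter_upwards [hext] with ω hω
    have he0 : 0 ≤ e ω := Real.exp_nonneg _
    nlinarith [huk _ hω, he1 ω]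
  have hval : ∫ ω, (k - e ω * u (ω (T ω))) ∂(P x) = k - ∫ ω, e ω * u (ω (T ω)) ∂(P x) := by
    rw [integral_sub (integrable_const _) hint]
    simp
  rw [indicator_of_mem hx, killed, ← lintegral_const_mul' _ _ ENNReal.ofReal_ne_top]
  calc ∫⁻ ω in survives D t, ENNReal.ofReal (Real.exp (-α * t)) *
        D.indicator (fun y => ENNReal.ofReal (k - u y)) (ω t) ∂(P x)
      ≤ ∫⁻ ω, ENNReal.ofReal (k - e ω * u (ω (T ω))) ∂(P x) := by
        rw [← lintegral_indicator (measurableSet_survives D t)]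
        refine lintegral_mono_ae ?_
        filter_upwards [hext, ae_survives_iff hD hA1 hA2 hx hsol,
          ae_exitMin_eq_approachTime hD hA1 hA2 hx hsol t] with ω hω hsurv hTω
        by_cases hs : ω ∈ survives D t
        · have hTt : T ω = t := by
            rw [hT, ← hTω, ← ENNReal.coe_inj, exitMin_coe]
            exact min_eq_right ((hsurv t).1 hs).le
          rw [indicator_of_mem hs, indicator_of_mem (path_mem_of_survives hs le_rfl),
            ← ENNReal.ofReal_mul (Real.exp_nonneg _)]
          refine ENNReal.ofReal_le_ofReal ?_
          have h1 := huk _ hω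
          rw [← hT, hTt] at h1
          rw [hTt]
          nlinarith [he1 ω, heα ω]
        · rw [indicator_of_notMem hs]
          exact zero_le
    _ = ENNReal.ofReal (k - ∫ ω, e ω * u (ω (T ω)) ∂(P x)) := by
        rw [← hval]
        exact (ofReal_integral_eq_lintegral_ofReal ((integrable_const _).sub hint) hnn).symm
    _ ≤ ENNReal.ofReal (k - u x) := ENNReal.ofReal_le_ofReal (by linarith)

end

/-- The Hopf lemma for weak subsolutions that do not attain their supremum `ν`-almost
everywhere on `D`. -/
theorem IsWeakSubsolution.exists_mul_le {d : ℕ} {D : Set (Space d)} {𝒜 : Coefficients d}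
    {P : Kernel (Space d) (CadlagPath d)} (hD : IsOpen D) (hne : D.Nonempty)
    (hA1 : 𝒜.A1 D) (hA2 : 𝒜.A2) (hP : IsStrongMarkovSolution 𝒜 P) (hET : ExitFinite P D)
    {c g u ψ : Space d → ℝ} (hc : IsBddBorelNonnegOn D c) {ν : Measure D}
    (hM : Minorization P D (sSup (c '' D)) ψ ν) (hu : IsWeakSubsolution P D c g u)
    (hsup : 0 ≤ sSup (u '' 𝒜.extDomain D))
    (hu0 : ¬ ∀ᵐ y : D ∂ν, u y = sSup (u '' 𝒜.extDomain D)) :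
    ∃ a : ℝ, 0 < a ∧ ∀ x ∈ D, a * ψ x ≤ sSup (u '' 𝒜.extDomain D) - u x := by
  set k := sSup (u '' 𝒜.extDomain D) with hk
  obtain ⟨C, hC⟩ := hu.bounded
  obtain ⟨Cc, hCc⟩ := hc.bounded
  have huk : ∀ x ∈ 𝒜.extDomain D, u x ≤ k := fun x hx =>
    le_csSup ⟨C, by rintro _ ⟨y, -, rfl⟩; exact (abs_le.1 (hC y)).2⟩ (mem_image_of_mem u hx)
  have hα : ∀ x ∈ D, c x ≤ sSup (c '' D) := fun x hx =>
    le_csSup ⟨Cc, by rintro _ ⟨y, hy, rfl⟩; exact hCc y hy⟩ (mem_image_of_mem c hx)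
  obtain ⟨x₀, hx₀⟩ := hne
  obtain ⟨a, ha, h⟩ := exists_mul_le_of_supermedian (C := ENNReal.ofReal (k + C)) hD
    hA1 hA2 hP hET ((hc.nonneg x₀ hx₀).trans (hα x₀ hx₀)) hM
    (w := D.indicator fun y => ENNReal.ofReal (k - u y))
    ((measurable_const.sub hu.measurable).ennreal_ofReal.indicator hD.measurableSet)
    ENNReal.ofReal_ne_top
    (fun y => indicator_apply_le' (fun _ => ENNReal.ofReal_le_ofReal (by
      linarith [(abs_le.1 (hC y)).1])) fun _ => zero_le)
    (fun t x hx => hu.killed_le hD hA1 hA2 hP hc hα hsup huk t hx)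
    (fun h => hu0 (by
      filter_upwards [h] with y hy
      rw [indicator_of_mem y.2, ENNReal.ofReal_eq_zero] at hy
      exact le_antisymm (huk _ (Or.inr y.2)) (by linarith)))
  refine ⟨a, ha, fun x hx => ?_⟩
  have h1 := h x hx
  rw [indicator_of_mem hx, ENNReal.ofReal_le_ofReal_iff (sub_nonneg.2 (huk x (Or.inr hx)))] at h1
  exact h1

end LevyHopf

end

open LevyHopf
theorem theorem3p4 {d : ℕ} (D : Set (Space d)) (hD : IsOpen D) (hDconn : IsConnected D)
    (𝒜 : Coefficients d) (hA1 : 𝒜.A1 D) (hA2 : 𝒜.A2)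
    (c : Space d → ℝ) (hA3 : IsBddBorelNonnegOn D c)
    (P : Kernel (Space d) (CadlagPath d)) (hA4 : IsStrongMarkovSolution 𝒜 P)
    (hET : ExitFinite P D)
    (g : Space d → ℝ) (hg : Measurable fun x : D => g x) (hg_nonpos : ∀ x ∈ D, g x ≤ 0)
    (ψ : Space d → ℝ) (hψ : ∀ x ∈ D, 0 < ψ x)
    (ν : Measure D) (hν : SigmaFinite ν)
    (hM : Minorization P D (sSup (c '' D)) ψ ν) :
    (ν.support = Set.univ →
      ∀ u : Space d → ℝ, IsWeakSubsolution P D c g u →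
        ContinuousOn u D → (¬ ∃ k : ℝ, ∀ x ∈ D, u x = k) →
        0 ≤ sSup (u '' 𝒜.extDomain D) →
        ∃ a : ℝ, 0 < a ∧ ∀ x ∈ D, a * ψ x ≤ sSup (u '' 𝒜.extDomain D) - u x) ∧
    (∀ m : Measure D, SigmaFinite m → m ≪ ν →
      ∀ u : Space d → ℝ, IsWeakSubsolution P D c g u →
        (¬ ∃ k : ℝ, ∀ᵐ x : D ∂m, u (x : Space d) = k) →
        0 ≤ sSup (u '' 𝒜.extDomain D) →
        ∃ a : ℝ, 0 < a ∧ ∀ x ∈ D, a * ψ x ≤ sSup (u '' 𝒜.extDomain D) - u x) := by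
  refine ⟨fun hsupp u hu hcont hconst hsup => ?_, fun m _ hm u hu hconst hsup => ?_⟩
  · refine hu.exists_mul_le hD hDconn.nonempty hA1 hA2 hA4 hET hA3 hM hsup fun h => hconst ?_
    refine ⟨sSup (u '' 𝒜.extDomain D), fun x hx => ?_⟩
    by_contra hx'
    -- By continuity, `u` differs from its supremum on a nonempty open set, which `ν` charges.
    have hopen : IsOpen {y : D | u y ≠ sSup (u '' 𝒜.extDomain D)} :=
      isOpen_compl_singleton.preimage (continuousOn_iff_continuous_domRestrict.1 hcont)
    refine Measure.subset_compl_support_of_isOpen hopen (ae_iff.1 h)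
      (show (⟨x, hx⟩ : D) ∈ _ from hx') ?_
    rw [hsupp]
    exact mem_univ _
  · exact hu.exists_mul_le hD hDconn.nonempty hA1 hA2 hA4 hET hA3 hM hsup fun h =>
      hconst ⟨_, hm.ae_le h⟩
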